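/- For a group $G$ and $x,y\in G$ put $[x,y]=x^{-1}y^{-1}xy$, $[x,{}_0y]=x$ and $[x,{}_{i+1}y]=[[x,{}_iy],y]$ for $i\ge 0$, and write $x\mapsto y$ if $[x,{}_ny]=1$ for some integer $n>0$. The Engel graph $\Gamma(G)$ is the directed graph whose vertices are the elements of $G\setminus Z_\infty(G)$, where $Z_\infty(G)$ is the hypercenter of $G$ (the union of the upper central series), with an edge from $x$ to $y$ if and only if $x\mapsto y$. It is strongly connected if for every ordered pair $(x,y)$ of vertices there is a directed path from $x$ to $y$. Theorem 5.4 (Suzuki groups). Let $t\ge 1$ be an integer, $q=2^{2t+1}$, so that $\sqrt{2q}=2^{t+1}$, and let $G=\mathrm{Sz}(q)$ be the Suzuki group over the field with $q$ elements. Then the Engel graph $\Gamma(G)$ is not strongly connected. Moreover, if $x\in G$, $x\neq 1$, has order dividing $q+\sqrt{2q}+1$, and $y\in G$ satisfies $x\mapsto y$, then the order of $y$ divides $q+\sqrt{2q}+1$. -/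

import Mathlib

/-- The hypercenter `Z_∞(G)`: the union of the upper central series of `G`
(for a finite group, its final term). -/
def hypercenter (G : Type*) [Group G] : Subgroup G :=
  ⨆ n : ℕ, Subgroup.upperCentralSeries G n

/-- The Engel word `[x, ₙ y]`: `[x, ₀ y] = x` and `[x, ₙ₊₁ y] = [[x, ₙ y], y]`, where
`[a, b] = a⁻¹ b⁻¹ a b`. -/
def engelWord {G : Type*} [Group G] (x y : G) : ℕ → G
  | 0 => x
  | n + 1 => (engelWord x y n)⁻¹ * y⁻¹ * engelWord x y n * y

/-- The relation `x ↦ y`: one has `[x, ₙ y] = 1` for some `n > 0`. -/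
def EngelEdge {G : Type*} [Group G] (x y : G) : Prop :=
  ∃ n : ℕ, 0 < n ∧ engelWord x y n = 1

/-- The Engel graph of `G`: the directed graph on the non-hypercentral elements of `G` with an
edge from `x` to `y` exactly when `x ↦ y`. -/
def engelGraph (G : Type*) [Group G] : Digraph {x : G // x ∉ hypercenter G} where
  Adj x y := EngelEdge (x : G) (y : G)

/-- A directed graph is strongly connected if there is a directed path from `x` to `y` for every
ordered pair `(x, y)` of vertices. -/
def IsStronglyConnectedDigraph {V : Type*} (Γ : Digraph V) : Prop :=
  ∀ x y : V, Relation.ReflTransGen Γ.Adj x y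

section Suzuki

variable (t : ℕ) {F : Type*} [Field F]

/-- The map `θ : a ↦ a ^ (2 ^ (t + 1))`. On the field with `2 ^ (2 * t + 1)` elements it is the
unique automorphism whose square is `a ↦ a ^ 2`, and its inverse is `a ↦ a ^ (2 ^ t)`. -/
def suzukiTheta (a : F) : F := a ^ (2 ^ (t + 1))

/-- The unipotent matrix `S(a, b)`. -/
def suzukiS (a b : F) : Matrix (Fin 4) (Fin 4) F :=
  !![1, 0, 0, 0;
     a, 1, 0, 0;
     b, suzukiTheta t a, 1, 0;
     a ^ 2 * suzukiTheta t a + a * b + suzukiTheta t b, a * suzukiTheta t a + b, a, 1]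

/-- The diagonal matrix with entries `c ^ (1 + 2 ^ t)`, `c ^ (2 ^ t)` and their inverses. -/
def suzukiM (c : Fˣ) : Matrix (Fin 4) (Fin 4) F :=
  !![(c : F) ^ (1 + 2 ^ t), 0, 0, 0;
     0, (c : F) ^ (2 ^ t), 0, 0;
     0, 0, ((c : F) ^ (2 ^ t))⁻¹, 0;
     0, 0, 0, ((c : F) ^ (1 + 2 ^ t))⁻¹]

/-- The antidiagonal permutation matrix. -/
def suzukiT (F : Type*) [Field F] : Matrix (Fin 4) (Fin 4) F :=
  !![0, 0, 0, 1;
     0, 0, 1, 0;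
     0, 1, 0, 0;
     1, 0, 0, 0]

theorem det_suzukiS (a b : F) : (suzukiS t a b).det = 1 := by
  simp [suzukiS, Matrix.det_succ_row_zero, Fin.sum_univ_succ, Fin.succAbove]

theorem det_suzukiM (c : Fˣ) : (suzukiM t c).det = 1 := by
  simp [suzukiM, Matrix.det_succ_row_zero, Fin.sum_univ_succ, Fin.succAbove]

theorem det_suzukiT : (suzukiT F).det = 1 := by
  simp [suzukiT, Matrix.det_succ_row_zero, Fin.sum_univ_succ, Fin.succAbove]
  norm_num

end Suzuki

/-- Suzuki's group `Sz(q)`, `q = 2 ^ (2 * t + 1)`, where `F` is the field with `q` elements: the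
subgroup of `SL(4, F)` generated by the matrices `S(a, b)` for `a b : F`, the diagonal matrices
`suzukiM t c` for `c : Fˣ`, and the antidiagonal permutation matrix. -/
def suzukiGroup (t : ℕ) (F : Type*) [Field F] :
    Subgroup (Matrix.SpecialLinearGroup (Fin 4) F) :=
  Subgroup.closure
    (Set.range (fun p : F × F =>
        (⟨suzukiS t p.1 p.2, det_suzukiS t p.1 p.2⟩ : Matrix.SpecialLinearGroup (Fin 4) F)) ∪
      Set.range (fun c : Fˣ =>
        (⟨suzukiM t c, det_suzukiM t c⟩ : Matrix.SpecialLinearGroup (Fin 4) F)) ∪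
      {(⟨suzukiT F, det_suzukiT⟩ : Matrix.SpecialLinearGroup (Fin 4) F)})

/-!
The Suzuki group is contained in the group of symplectic `4 × 4` matrices `g` over the field with
`q` elements whose action on the four-dimensional section of the exterior square is the twist of `g`
by the automorphism `θ` with `θ² = 2` (`IsSuzukiMatrix`); this property is checked on generators and
is closed under products. It determines the characteristic polynomial of `g` from its trace `a`:
`X⁴ + a X³ + θ(a) X² + a X + 1` (`IsSuzukiMatrix.charpoly`). If `a = 0`, then `g⁴ = 1`. If `a ≠ 0`,
then the four eigenvalues are distinct, and the relation between `a` and `θ(a)` forces all of them to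
be roots of unity of order dividing `q - 1`, `q - √(2q) + 1` or `q + √(2q) + 1`
(`exists_distinct_roots`). These three numbers are prime to `24`, and the last one is prime to the
other two.

Let `x ≠ 1` have order dividing `q + √(2q) + 1`, and let `x ↦ y` with `y ≠ 1`. The Engel word is
climbed back from its trivial term to `x`, along a property that `w` inherits from `[w, y]`.

* If `y` has nonzero trace, the property is that `w` permutes the four eigenlines of `y`. As no
  element of order prime to `4!` permutes four lines nontrivially, `x` is diagonal in the eigenbasis
  of `y` and commutes with `y` (`EngelEdge.commute_of_diagonal`). If the order of `y` divided another
  of the three numbers, then the order of `x y` would have two nontrivial coprime factors taken from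
  two of them, which is impossible (`pow_eq_one_of_commute`).
* If `y` is a `2`-element, it fixes a point of the Suzuki–Tits ovoid, which has `q² + 1` points, and
  it fixes only one (`exists_eq_smul_of_mulVec_eq`). The property is that `w` fixes this point. Then
  `x` has an eigenvalue in the field with `q` elements, which must be `1`, and `x⁴ = 1`; so this case
  does not occur (`EngelEdge.eq_one_of_pow_four_eq_one`).

This proves the statement on orders. Nontrivial elements of order dividing `q + √(2q) + 1` exist
because the trace takes every value (`exists_ne_one_pow_eq_one_of_isAlgClosed`). By the statement on
orders, a nontrivial central element and then the antidiagonal involution would have order dividing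
this odd number; so the center is trivial, and with it the hypercenter. For the same reason no
directed path leads from such an element to the involution.
-/

open Matrix

/-! ### The field automorphism -/

theorem charP_two_of_card {t : ℕ} {F : Type*} [Field F] (hF : Nat.card F = 2 ^ (2 * t + 1)) :
    CharP F 2 := by
  have : Finite F := Nat.finite_of_card_ne_zero (by rw [hF]; positivity)
  have := Fintype.ofFinite F
  refine CharTwo.of_one_ne_zero_of_two_eq_zero one_ne_zero ?_
  have h := FiniteField.cast_card_eq_zero F
  rw [← Nat.card_eq_fintype_card, hF] at h
  push_cast at h
  exact pow_eq_zero_iff (by omega) |>.1 h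

theorem pow_card_eq {t : ℕ} {F : Type*} [Field F] (hF : Nat.card F = 2 ^ (2 * t + 1)) (a : F) :
    a ^ (2 ^ (2 * t + 1)) = a := by
  have : Finite F := Nat.finite_of_card_ne_zero (by rw [hF]; positivity)
  have := Fintype.ofFinite F
  rw [← hF, Nat.card_eq_fintype_card]
  exact FiniteField.pow_card a

section Theta

variable {t : ℕ} {F : Type*} [Field F]

theorem suzukiTheta_mul (a b : F) :
    suzukiTheta t (a * b) = suzukiTheta t a * suzukiTheta t b := mul_pow a b _

theorem suzukiTheta_pow (a : F) (n : ℕ) :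
    suzukiTheta t (a ^ n) = suzukiTheta t a ^ n := pow_right_comm a n _

theorem suzukiTheta_inv (a : F) : suzukiTheta t a⁻¹ = (suzukiTheta t a)⁻¹ := inv_pow a _

@[simp] theorem suzukiTheta_zero : suzukiTheta t (0 : F) = 0 := zero_pow (by positivity)

@[simp] theorem suzukiTheta_one : suzukiTheta t (1 : F) = 1 := one_pow _

theorem suzukiTheta_eq_zero_iff {a : F} : suzukiTheta t a = 0 ↔ a = 0 :=
  pow_eq_zero_iff (by positivity)

theorem suzukiTheta_add [CharP F 2] (a b : F) :
    suzukiTheta t (a + b) = suzukiTheta t a + suzukiTheta t b :=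
  add_pow_char_pow a b 2 (t + 1)

theorem suzukiTheta_suzukiTheta (hF : Nat.card F = 2 ^ (2 * t + 1)) (a : F) :
    suzukiTheta t (suzukiTheta t a) = a ^ 2 := by
  have h : 2 ^ (t + 1) * 2 ^ (t + 1) = 2 ^ (2 * t + 1) * 2 := by ring
  rw [suzukiTheta, suzukiTheta, ← pow_mul, h, pow_mul, pow_card_eq hF]

theorem suzukiTheta_pow_two_pow (hF : Nat.card F = 2 ^ (2 * t + 1)) (a : F) :
    suzukiTheta t (a ^ 2 ^ t) = a := by
  have h : 2 ^ t * 2 ^ (t + 1) = 2 ^ (2 * t + 1) := by ring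
  rw [suzukiTheta, ← pow_mul, h, pow_card_eq hF]

end Theta

/-! ### Suzuki matrices -/

/-! ### Suzuki matrices -/

/-- The `2 × 2` minor of `g` on rows `p` and columns `r`. -/
def pairMinor {F : Type*} [Field F] (g : Matrix (Fin 4) (Fin 4) F) (p r : Fin 4 × Fin 4) : F :=
  g p.1 r.1 * g p.2 r.2 - g p.1 r.2 * g p.2 r.1

/-- The pairs of coordinates, in the order that matches the standard coordinates, which index the
four-dimensional section of the exterior square of the symplectic space. -/
def sectionPair : Fin 4 → Fin 4 × Fin 4 := ![(0, 1), (0, 2), (1, 3), (2, 3)]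

/-- The equations that cut out the Suzuki group: `g` preserves the alternating form with
antidiagonal Gram matrix, and its action on the four-dimensional section of the exterior square is
the twist of `g` by `θ`. -/
structure IsSuzukiMatrix (t : ℕ) {F : Type*} [Field F] (g : Matrix (Fin 4) (Fin 4) F) : Prop where
  form : gᵀ * suzukiT F * g = suzukiT F
  minor : ∀ i j, pairMinor g (sectionPair i) (sectionPair j) = suzukiTheta t (g i j)

section Symplectic

variable {F : Type*} [Field F] {g : Matrix (Fin 4) (Fin 4) F}

theorem suzukiT_mul_self : suzukiT F * suzukiT F = 1 := by
  ext i j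
  fin_cases i <;> fin_cases j <;> simp [suzukiT, Matrix.mul_apply, Fin.sum_univ_four]

theorem form_transpose (h : gᵀ * suzukiT F * g = suzukiT F) :
    g * suzukiT F * gᵀ = suzukiT F := by
  have h1 : (suzukiT F * gᵀ * suzukiT F) * g = 1 := by
    rw [Matrix.mul_assoc, Matrix.mul_assoc, ← Matrix.mul_assoc gᵀ, h, suzukiT_mul_self]
  have h2 := mul_eq_one_comm.1 h1
  calc g * suzukiT F * gᵀ = g * (suzukiT F * gᵀ * suzukiT F) * suzukiT F := by
        simp only [Matrix.mul_assoc, suzukiT_mul_self, Matrix.mul_one]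
    _ = _ := by rw [h2, Matrix.one_mul]

variable [CharP F 2]

theorem pairMinor_add_of_form (h : gᵀ * suzukiT F * g = suzukiT F) (p : Fin 4 × Fin 4) :
    pairMinor g (0, 3) p + pairMinor g (1, 2) p = suzukiT F p.1 p.2 := by
  have h2 : (2 : F) = 0 := CharTwo.two_eq_zero
  rw [← h]
  simp [pairMinor, suzukiT, Matrix.mul_apply, Fin.sum_univ_four]
  linear_combination (-g 3 p.1 * g 0 p.2 - g 2 p.1 * g 1 p.2) * h2

theorem pairMinor_add_of_form' (h : gᵀ * suzukiT F * g = suzukiT F) (p : Fin 4 × Fin 4) :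
    pairMinor g p (0, 3) + pairMinor g p (1, 2) = suzukiT F p.1 p.2 := by
  have h2 : (2 : F) = 0 := CharTwo.two_eq_zero
  rw [← form_transpose h]
  simp [pairMinor, suzukiT, Matrix.mul_apply, Fin.sum_univ_four]
  linear_combination (- g p.1 3 * g p.2 0 - g p.1 2 * g p.2 1) * h2

end Symplectic

/-- The Cauchy–Binet formula for `2 × 2` minors. -/
theorem pairMinor_mul {F : Type*} [Field F] (g h : Matrix (Fin 4) (Fin 4) F)
    (p r : Fin 4 × Fin 4) :
    pairMinor (g * h) p r = ∑ i, pairMinor g p (sectionPair i) * pairMinor h (sectionPair i) r +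
      pairMinor g p (0, 3) * pairMinor h (0, 3) r +
      pairMinor g p (1, 2) * pairMinor h (1, 2) r := by
  simp only [pairMinor, sectionPair, Matrix.mul_apply, Fin.sum_univ_four, Matrix.cons_val]
  ring

theorem suzukiT_sectionPair {F : Type*} [Field F] (i : Fin 4) :
    suzukiT F (sectionPair i).1 (sectionPair i).2 = 0 := by
  fin_cases i <;> simp [suzukiT, sectionPair]

namespace IsSuzukiMatrix

variable {t : ℕ} {F : Type*} [Field F]

theorem one : IsSuzukiMatrix t (1 : Matrix (Fin 4) (Fin 4) F) where
  form := by simp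
  minor i j := by
    fin_cases i <;> fin_cases j <;> simp [pairMinor, sectionPair, Matrix.one_apply]

theorem mul [CharP F 2] {g h : Matrix (Fin 4) (Fin 4) F} (hg : IsSuzukiMatrix t g)
    (hh : IsSuzukiMatrix t h) : IsSuzukiMatrix t (g * h) where
  form := by
    calc (g * h)ᵀ * suzukiT F * (g * h) = hᵀ * (gᵀ * suzukiT F * g) * h := by
          simp only [Matrix.transpose_mul, Matrix.mul_assoc]
      _ = _ := by rw [hg.form, hh.form]
  minor i j := by
    have h2 : (2 : F) = 0 := CharTwo.two_eq_zero
    have e1 := pairMinor_add_of_form' hg.form (sectionPair i)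
    have e2 := pairMinor_add_of_form hh.form (sectionPair j)
    rw [suzukiT_sectionPair] at e1 e2
    rw [pairMinor_mul, Matrix.mul_apply]
    simp only [hg.minor, hh.minor, Fin.sum_univ_four, suzukiTheta_add, suzukiTheta_mul]
    linear_combination pairMinor h (0, 3) (sectionPair j) * e1 +
      pairMinor g (sectionPair i) (1, 2) * e2
      - pairMinor g (sectionPair i) (1, 2) * pairMinor h (0, 3) (sectionPair j) * h2

theorem suzukiT [CharP F 2] : IsSuzukiMatrix t (suzukiT F) where
  form := by
    have : (_root_.suzukiT F)ᵀ = _root_.suzukiT F := by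
      ext i j; fin_cases i <;> fin_cases j <;> simp [_root_.suzukiT]
    rw [this, Matrix.mul_assoc, suzukiT_mul_self, Matrix.mul_one]
  minor i j := by
    fin_cases i <;> fin_cases j <;>
      simp [_root_.suzukiT, pairMinor, sectionPair, CharTwo.neg_eq]

theorem suzukiM (hF : Nat.card F = 2 ^ (2 * t + 1)) (c : Fˣ) :
    IsSuzukiMatrix t (suzukiM t c) where
  form := by
    ext i j
    fin_cases i <;> fin_cases j <;>
      simp [_root_.suzukiM, _root_.suzukiT, Matrix.mul_apply, Fin.sum_univ_four]
  minor i j := by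
    have hc : (c : F) ≠ 0 := c.ne_zero
    have e := suzukiTheta_pow_two_pow hF (c : F)
    have e' : suzukiTheta t (c : F) = ((c : F) ^ 2 ^ t) ^ 2 := by
      rw [suzukiTheta, ← pow_mul, pow_succ]
    fin_cases i <;> fin_cases j <;>
      simp [_root_.suzukiM, pairMinor, sectionPair, suzukiTheta_inv, suzukiTheta_mul, pow_add, e,
        e'] <;> field_simp

theorem suzukiS [CharP F 2] (hF : Nat.card F = 2 ^ (2 * t + 1)) (a b : F) :
    IsSuzukiMatrix t (suzukiS t a b) where
  form := by
    have h2 : (2 : F) = 0 := CharTwo.two_eq_zero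
    ext i j
    fin_cases i <;> fin_cases j <;>
      simp [_root_.suzukiS, _root_.suzukiT, Matrix.mul_apply, Fin.sum_univ_four] <;> grind
  minor i j := by
    have h2 : (2 : F) = 0 := CharTwo.two_eq_zero
    have ha := suzukiTheta_suzukiTheta hF a
    have hb := suzukiTheta_suzukiTheta hF b
    fin_cases i <;> fin_cases j <;>
      simp [_root_.suzukiS, pairMinor, sectionPair, suzukiTheta_add, suzukiTheta_mul,
        suzukiTheta_pow, ha, hb] <;> grind

end IsSuzukiMatrix

/-! ### The characteristic polynomial of a Suzuki matrix -/

open Polynomial in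
/-- The characteristic polynomial of a `4 × 4` matrix in terms of principal minors. -/
theorem charpoly_fin_four {F : Type*} [Field F] (g : Matrix (Fin 4) (Fin 4) F) :
    g.charpoly = X ^ 4 - C g.trace * X ^ 3 +
      C (∑ i, pairMinor g (sectionPair i) (sectionPair i) + pairMinor g (0, 3) (0, 3) +
        pairMinor g (1, 2) (1, 2)) * X ^ 2 - C g.adjugate.trace * X + C g.det := by
  have e1 : (1 : Fin 4).succAbove 0 = 0 := rfl
  have e2 : (1 : Fin 4).succAbove 1 = 2 := rfl
  have e3 : (1 : Fin 4).succAbove 2 = 3 := rfl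
  have e4 : (2 : Fin 4).succAbove 0 = 0 := rfl
  have e5 : (2 : Fin 4).succAbove 1 = 1 := rfl
  have e6 : (2 : Fin 4).succAbove 2 = 3 := rfl
  have e7 : (3 : Fin 4).succAbove 0 = 0 := rfl
  have e8 : (3 : Fin 4).succAbove 1 = 1 := rfl
  have e9 : (3 : Fin 4).succAbove 2 = 2 := rfl
  have e10 : (0 : Fin 4).succAbove 0 = 1 := rfl
  have e11 : (0 : Fin 4).succAbove 1 = 2 := rfl
  have e12 : (0 : Fin 4).succAbove 2 = 3 := rfl
  simp only [Matrix.charpoly, Matrix.trace, Matrix.diag, adjugate_fin_succ_eq_det_submatrix,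
    Matrix.det_succ_row_zero (n := 3), Fin.sum_univ_four, Matrix.det_fin_three,
    Matrix.submatrix_apply, e1, e2, e3, e4, e5, e6, e7, e8, e9, e10, e11, e12, pairMinor,
    sectionPair, Matrix.cons_val, Matrix.charmatrix_apply, Fin.succ_zero_eq_one,
    Fin.succ_one_eq_two, Fin.reduceSucc, Matrix.diagonal_apply, Fin.reduceEq, if_true, if_false,
    map_add, map_sub, map_mul,
    map_pow, map_neg, map_one, zero_sub, Fin.isValue, Fin.coe_ofNat_eq_mod]
  ring

namespace IsSuzukiMatrix

variable {t : ℕ} {F : Type*} [Field F] [CharP F 2] {g : Matrix (Fin 4) (Fin 4) F}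

open Polynomial in
/-- The exterior square of a Suzuki matrix has two trivial composition factors besides the twist of
the matrix by `θ`, so the middle coefficient of the characteristic polynomial is `θ` of the
trace. -/
theorem charpoly (h : IsSuzukiMatrix t g) (hdet : g.det = 1) :
    g.charpoly = X ^ 4 + C g.trace * X ^ 3 + C (suzukiTheta t g.trace) * X ^ 2 +
      C g.trace * X + 1 := by
  have h2 : (2 : F) = 0 := CharTwo.two_eq_zero
  have hadj : g.adjugate = _root_.suzukiT F * gᵀ * _root_.suzukiT F := by
    have h1 : (_root_.suzukiT F * gᵀ * _root_.suzukiT F) * g = 1 := by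
      rw [Matrix.mul_assoc, Matrix.mul_assoc, ← Matrix.mul_assoc gᵀ, h.form, suzukiT_mul_self]
    have h3 := Matrix.adjugate_mul g
    rw [hdet, one_smul] at h3
    calc g.adjugate = g.adjugate * (g * (_root_.suzukiT F * gᵀ * _root_.suzukiT F)) := by
          rw [mul_eq_one_comm.1 h1, Matrix.mul_one]
      _ = _ := by rw [← Matrix.mul_assoc, h3, Matrix.one_mul]
  have htr : g.adjugate.trace = g.trace := by
    rw [hadj, Matrix.trace_mul_comm, ← Matrix.mul_assoc, suzukiT_mul_self, Matrix.one_mul,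
      Matrix.trace_transpose]
  have hmid : ∑ i, pairMinor g (sectionPair i) (sectionPair i) + pairMinor g (0, 3) (0, 3) +
      pairMinor g (1, 2) (1, 2) = suzukiTheta t g.trace := by
    have e1 := pairMinor_add_of_form h.form (1, 2)
    have e2 := pairMinor_add_of_form' h.form (0, 3)
    have e3 : _root_.suzukiT F 1 2 = 1 := by simp [_root_.suzukiT]
    have e4 : _root_.suzukiT F 0 3 = 1 := by simp [_root_.suzukiT]
    simp only [e3, e4] at e1 e2
    simp only [h.minor, Fin.sum_univ_four, Matrix.trace, Matrix.diag, suzukiTheta_add]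
    linear_combination e1 + e2 + (1 - pairMinor g (0, 3) (1, 2)) * h2
  rw [charpoly_fin_four, hmid, htr, hdet, CharTwo.sub_eq_add, CharTwo.sub_eq_add, C_1]

theorem aeval_self (h : IsSuzukiMatrix t g) (hdet : g.det = 1) :
    g ^ 4 + g.trace • g ^ 3 + suzukiTheta t g.trace • g ^ 2 + g.trace • g + 1 = 0 := by
  have := Matrix.aeval_self_charpoly g
  rw [h.charpoly hdet] at this
  simpa [Algebra.smul_def] using this

theorem pow_four_eq_one (h : IsSuzukiMatrix t g) (hdet : g.det = 1) (htr : g.trace = 0) :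
    g ^ 4 = 1 := by
  have := h.aeval_self hdet
  simp only [htr, suzukiTheta_zero, zero_smul, add_zero] at this
  have h2 : (-1 : Matrix (Fin 4) (Fin 4) F) = 1 := by
    ext i j; simp [CharTwo.neg_eq]
  rw [← h2]
  exact eq_neg_of_add_eq_zero_left this

theorem trace_eq_zero_of_mulVec_eq (h : IsSuzukiMatrix t g) (hdet : g.det = 1) {v : Fin 4 → F}
    (hv : v ≠ 0) (hgv : g *ᵥ v = v) : g.trace = 0 := by
  have h2 : (2 : F) = 0 := CharTwo.two_eq_zero
  have h3 : (g ^ 4 + g.trace • g ^ 3 + suzukiTheta t g.trace • g ^ 2 + g.trace • g + 1) *ᵥ v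
      = 0 := by rw [h.aeval_self hdet, Matrix.zero_mulVec]
  simp only [Matrix.add_mulVec, Matrix.smul_mulVec, pow_succ, pow_zero, ← Matrix.mulVec_mulVec,
    Matrix.one_mulVec, hgv] at h3
  obtain ⟨i, hi⟩ := Function.ne_iff.1 hv
  have h4 := congrFun h3 i
  simp only [Pi.add_apply, Pi.smul_apply, smul_eq_mul, Pi.zero_apply] at h4 hi
  have h5 : suzukiTheta t g.trace * v i = 0 := by
    linear_combination h4 - (1 + g.trace) * v i * h2
  exact suzukiTheta_eq_zero_iff.1 ((mul_eq_zero.1 h5).resolve_right hi)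

end IsSuzukiMatrix

/-! ### Torus orders and eigenvalues -/

/-- The orders of the three kinds of maximal tori of the Suzuki group. -/
def torusOrders (t : ℕ) : Set ℕ :=
  {2 ^ (2 * t + 1) - 1, 2 ^ (2 * t + 1) + 1 - 2 ^ (t + 1), 2 ^ (2 * t + 1) + 2 ^ (t + 1) + 1}

section Arithmetic

theorem two_pow_mul_self_eq (t : ℕ) : 2 ^ (t + 1) * 2 ^ (t + 1) = 2 * 2 ^ (2 * t + 1) := by ring

theorem two_pow_succ_le (t : ℕ) : 2 ^ (t + 1) ≤ 2 ^ (2 * t + 1) :=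
  Nat.pow_le_pow_right (by norm_num) (by omega)

theorem coprime_of_mem_torusOrders {t n : ℕ} (hn : n ∈ torusOrders t) : n.Coprime 24 := by
  have hle := two_pow_succ_le t
  have h1 : 2 ^ (2 * t + 1) = 2 * 4 ^ t := by rw [pow_succ, pow_mul]; norm_num [mul_comm]
  have h2 : 2 ^ (t + 1) = 2 * 2 ^ t := by ring
  have h3 : 4 ^ t % 3 = 1 := by simp [Nat.pow_mod]
  have h4 : 2 ^ t % 3 ≠ 0 := fun h => by
    have := Nat.prime_three.dvd_of_dvd_pow (Nat.dvd_of_mod_eq_zero h)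
    omega
  have hpos : 0 < 4 ^ t := by positivity
  have key : n % 2 = 1 ∧ n % 3 ≠ 0 := by
    rcases hn with rfl | rfl | rfl <;> omega
  have c2 : n.Coprime 2 := Nat.coprime_two_right.2 (Nat.odd_iff.2 key.1)
  have c3 : n.Coprime 3 :=
    ((Nat.Prime.coprime_iff_not_dvd Nat.prime_three).2
      fun h => key.2 (Nat.mod_eq_zero_of_dvd h)).symm
  exact (c2.pow_right 3).mul_right c3

theorem coprime_two_of_mem_torusOrders {t n : ℕ} (hn : n ∈ torusOrders t) : n.Coprime 2 :=
  (coprime_of_mem_torusOrders hn).coprime_dvd_right (by norm_num)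

theorem coprime_torusOrders {t n : ℕ} (hn : n ∈ torusOrders t)
    (hne : n ≠ 2 ^ (2 * t + 1) + 2 ^ (t + 1) + 1) :
    (2 ^ (2 * t + 1) + 2 ^ (t + 1) + 1).Coprime n := by
  have hle := two_pow_succ_le t
  have hmul := two_pow_mul_self_eq t
  have hodd := coprime_two_of_mem_torusOrders hn
  rcases hn with rfl | rfl | rfl
  · have h1 : (2 ^ (2 * t + 1) + 2 ^ (t + 1) + 1) * (2 ^ (2 * t + 1) + 1 - 2 ^ (t + 1)) =
        2 + (2 ^ (2 * t + 1) - 1) * (2 ^ (2 * t + 1) + 1) := by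
      zify [hle, show 2 ^ (t + 1) ≤ 2 ^ (2 * t + 1) + 1 by omega, Nat.one_le_two_pow] at hmul ⊢
      linear_combination -hmul
    have h2 : (2 + (2 ^ (2 * t + 1) - 1) * (2 ^ (2 * t + 1) + 1)).Coprime
        (2 ^ (2 * t + 1) - 1) := by
      rw [Nat.coprime_add_mul_left_left]
      exact hodd.symm
    rw [← h1] at h2
    exact h2.coprime_dvd_left (dvd_mul_right _ _)
  · have h1 : 2 ^ (2 * t + 1) + 2 ^ (t + 1) + 1 =
        2 ^ (t + 2) + (2 ^ (2 * t + 1) + 1 - 2 ^ (t + 1)) := by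
      have : 2 ^ (t + 2) = 2 * 2 ^ (t + 1) := by ring
      omega
    rw [h1, Nat.coprime_add_self_left]
    exact (hodd.pow_right (t + 2)).symm
  · exact absurd rfl hne

end Arithmetic

section Roots

variable {K : Type*} [Field K]

theorem eq_or_eq_inv_of_add_inv_eq {x y : K} (hx : x ≠ 0) (hy : y ≠ 0)
    (h : x + x⁻¹ = y + y⁻¹) : x = y ∨ x = y⁻¹ := by
  have : (x - y) * (x * y - 1) = 0 := by
    field_simp at h
    linear_combination h
  rcases mul_eq_zero.1 this with h | h
  · exact Or.inl (sub_eq_zero.1 h)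
  · exact Or.inr (eq_inv_of_mul_eq_one_left (sub_eq_zero.1 h))

variable [CharP K 2]

theorem eq_of_sq_eq_sq_charTwo {x y : K} (h : x ^ 2 = y ^ 2) : x = y :=
  frobenius_inj K 2 (by simpa [frobenius_def] using h)

/-- If `x ↦ x ^ √(2q)` acts on `{l ^ ±1, m ^ ±1}` as `l ↦ (l m) ^ ±1`, `m ↦ (l / m) ^ ±1`, then the
choice of the signs determines which torus order kills `l` and `m`. -/
theorem exists_torusOrder_pow_eq_one {t : ℕ} {l m : K} (hl : l ≠ 0) (hm : m ≠ 0)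
    (h1 : l ^ 2 ^ (t + 1) = l * m ∨ l ^ 2 ^ (t + 1) = (l * m)⁻¹)
    (h2 : m ^ 2 ^ (t + 1) = l * m⁻¹ ∨ m ^ 2 ^ (t + 1) = (l * m⁻¹)⁻¹) :
    ∃ n ∈ torusOrders t, l ^ n = 1 ∧ m ^ n = 1 := by
  have hle := two_pow_succ_le t
  have hpow : ∀ x : K, (x ^ 2 ^ (t + 1)) ^ 2 ^ (t + 1) = (x ^ 2 ^ (2 * t + 1)) ^ 2 := fun x => by
    rw [← pow_mul, ← pow_mul, two_pow_mul_self_eq, mul_comm]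
  have hq1 : ∀ x : K, x ≠ 0 → x ^ 2 ^ (2 * t + 1) = x → x ^ (2 ^ (2 * t + 1) - 1) = 1 :=
    fun x hx h => by
      rw [pow_sub₀ x hx Nat.one_le_two_pow, h, pow_one, mul_inv_cancel₀ hx]
  have hq2 : ∀ x : K, x ≠ 0 → x ^ 2 ^ (2 * t + 1) * x = x ^ 2 ^ (t + 1) →
      x ^ (2 ^ (2 * t + 1) + 1 - 2 ^ (t + 1)) = 1 := fun x hx h => by
    rw [pow_sub₀ x hx (by omega), pow_succ, h, mul_inv_cancel₀ (pow_ne_zero _ hx)]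
  have hll := hpow l
  have hmm := hpow m
  rcases h1 with h1 | h1 <;> rcases h2 with h2 | h2 <;>
    simp only [h1, h2, mul_pow, inv_pow] at hll hmm
  · refine ⟨_, Or.inl rfl, hq1 l hl (eq_of_sq_eq_sq_charTwo ?_),
      hq1 m hm (eq_of_sq_eq_sq_charTwo ?_)⟩
    · rw [← hll]; field_simp
    · rw [← hmm]; field_simp
  · have e1 : l ^ 2 ^ (2 * t + 1) = m := eq_of_sq_eq_sq_charTwo (by rw [← hll]; field_simp)
    have e2 : m ^ 2 ^ (2 * t + 1) = l⁻¹ := eq_of_sq_eq_sq_charTwo (by rw [← hmm]; field_simp)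
    refine ⟨_, Or.inr (Or.inl rfl), hq2 l hl ?_, hq2 m hm ?_⟩
    · rw [e1, h1, mul_comm]
    · rw [e2, h2]; field_simp
  · have e1 : l ^ 2 ^ (2 * t + 1) = m := eq_of_sq_eq_sq_charTwo (by rw [← hll]; field_simp)
    have e2 : m ^ 2 ^ (2 * t + 1) = l⁻¹ := eq_of_sq_eq_sq_charTwo (by rw [← hmm]; field_simp)
    refine ⟨_, Or.inr (Or.inr rfl), ?_, ?_⟩
    · rw [pow_succ, pow_add, e1, h1]; field_simp
    · rw [pow_succ, pow_add, e2, h2]; field_simp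
  · refine ⟨_, Or.inl rfl, hq1 l hl (eq_of_sq_eq_sq_charTwo ?_),
      hq1 m hm (eq_of_sq_eq_sq_charTwo ?_)⟩
    · rw [← hll]; field_simp
    · rw [← hmm]; field_simp

/-- The four roots `l, l⁻¹, m, m⁻¹` of the characteristic polynomial of a Suzuki matrix of nonzero
trace `a` are distinct, and a torus order kills all of them. The sums `s = l + l⁻¹` and
`s' = m + m⁻¹` satisfy `s + s' = a` and `s s' = a ^ √(2q)`, so that `s ^ √(2q)` and `s' ^ √(2q)` have
the same elementary symmetric functions as `l m + (l m)⁻¹` and `l m⁻¹ + l⁻¹ m`. -/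
theorem exists_distinct_roots [IsAlgClosed K] {t : ℕ} {a l : K} (ha : a ≠ 0)
    (haq : a ^ 2 ^ (2 * t + 1) = a)
    (hl : l ^ 4 + a * l ^ 3 + a ^ 2 ^ (t + 1) * l ^ 2 + a * l + 1 = 0) :
    ∃ d : Fin 4 → K, Function.Injective d ∧ d 0 = l ∧
      (∀ i, d i ^ 4 + a * d i ^ 3 + a ^ 2 ^ (t + 1) * d i ^ 2 + a * d i + 1 = 0) ∧
      ∃ n ∈ torusOrders t, ∀ i, d i ^ n = 1 := by
  have h2 : (2 : K) = 0 := CharTwo.two_eq_zero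
  have hl0 : l ≠ 0 := by rintro rfl; simp at hl
  obtain ⟨s, hs⟩ : ∃ s, s = l + l⁻¹ := ⟨_, rfl⟩
  have hs2 : a ^ 2 ^ (t + 1) = s * (s + a) := by
    have : l ^ 2 * (a ^ 2 ^ (t + 1) - s * (s + a)) = 0 := by
      rw [hs]; field_simp
      linear_combination hl - (l ^ 4 + l ^ 2 + a * l ^ 3 + a * l + 1) * h2
    have := (mul_eq_zero.1 this).resolve_left (pow_ne_zero 2 hl0)
    exact sub_eq_zero.1 this
  obtain ⟨m, hm⟩ : ∃ m : K, m ^ 2 + (s + a) * m + 1 = 0 := by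
    have hdeg : (Polynomial.C 1 * Polynomial.X ^ 2 + Polynomial.C (s + a) * Polynomial.X +
        Polynomial.C 1).degree = 2 := Polynomial.degree_quadratic one_ne_zero
    obtain ⟨m, hm⟩ := IsAlgClosed.exists_root _ (by rw [hdeg]; norm_num)
    exact ⟨m, by simpa using hm⟩
  have hm0 : m ≠ 0 := by rintro rfl; simp at hm
  have hs' : s + a = m + m⁻¹ := by
    field_simp
    linear_combination hm - (m ^ 2 + 1) * h2
  have hr0 : a ^ 2 ^ (t + 1) ≠ 0 := pow_ne_zero _ ha
  have hsne : s ≠ 0 := by rintro rfl; simp at hs2; exact ha hs2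
  have hsne' : s + a ≠ 0 := by intro h; rw [h, mul_zero] at hs2; exact hr0 hs2
  have hadd : ∀ x : K,
      (x + x⁻¹) ^ 2 ^ (t + 1) = x ^ 2 ^ (t + 1) + (x ^ 2 ^ (t + 1))⁻¹ := fun x => by
    rw [add_pow_char_pow, inv_pow]
  have hls := hadd l
  have hms := hadd m
  rw [← hs] at hls
  rw [← hs'] at hms
  have hsum : s ^ 2 ^ (t + 1) + (s + a) ^ 2 ^ (t + 1) = s * (s + a) := by
    rw [add_pow_char_pow, ← hs2]
    linear_combination s ^ 2 ^ (t + 1) * h2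
  have hprod : s ^ 2 ^ (t + 1) * (s + a) ^ 2 ^ (t + 1) = s ^ 2 + (s + a) ^ 2 := by
    rw [← mul_pow, ← hs2, ← pow_mul, two_pow_mul_self_eq, mul_comm 2, pow_mul, haq]
    linear_combination (-s ^ 2 - s * a) * h2
  -- Up to exchanging `m` and `m⁻¹`, the power `s ^ √(2q)` is `l m + (l m)⁻¹`.
  obtain ⟨m, hm0, hs', hms, h1, h3⟩ : ∃ m : K, m ≠ 0 ∧ s + a = m + m⁻¹ ∧
      (s + a) ^ 2 ^ (t + 1) = m ^ 2 ^ (t + 1) + (m ^ 2 ^ (t + 1))⁻¹ ∧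
      s ^ 2 ^ (t + 1) = l * m + (l * m)⁻¹ ∧
      (s + a) ^ 2 ^ (t + 1) = l * m⁻¹ + (l * m⁻¹)⁻¹ := by
    have hsym : l * m + (l * m)⁻¹ + (l * m⁻¹ + (l * m⁻¹)⁻¹) = s * (s + a) := by
      rw [hs', hs]; field_simp; ring
    have hsym2 : (l * m + (l * m)⁻¹) * (l * m⁻¹ + (l * m⁻¹)⁻¹) = s ^ 2 + (s + a) ^ 2 := by
      rw [hs', hs]; field_simp
      linear_combination (-2 * l ^ 2 * m ^ 2) * h2
    have hfac : (s ^ 2 ^ (t + 1) - (l * m + (l * m)⁻¹)) *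
        (s ^ 2 ^ (t + 1) - (l * m⁻¹ + (l * m⁻¹)⁻¹)) = 0 := by
      linear_combination s ^ 2 ^ (t + 1) * hsum - hprod - s ^ 2 ^ (t + 1) * hsym + hsym2
    rcases mul_eq_zero.1 hfac with h | h
    · refine ⟨m, hm0, hs', hms, sub_eq_zero.1 h, ?_⟩
      linear_combination hsum - hsym - h
    · refine ⟨m⁻¹, inv_ne_zero hm0, by rw [hs', inv_inv, add_comm], by
        rw [hms, inv_pow, inv_inv, add_comm], sub_eq_zero.1 h, ?_⟩
      rw [inv_inv]
      linear_combination hsum - hsym - h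
  rw [hls] at h1
  rw [hms] at h3
  obtain ⟨n, hn, hln, hmn⟩ := exists_torusOrder_pow_eq_one (t := t) hl0 hm0
    (eq_or_eq_inv_of_add_inv_eq (pow_ne_zero _ hl0) (mul_ne_zero hl0 hm0) h1)
    (eq_or_eq_inv_of_add_inv_eq (pow_ne_zero _ hm0) (mul_ne_zero hl0 (inv_ne_zero hm0)) h3)
  have hroot : ∀ x : K, x ≠ 0 → (x + x⁻¹ = s ∨ x + x⁻¹ = s + a) →
      x ^ 4 + a * x ^ 3 + a ^ 2 ^ (t + 1) * x ^ 2 + a * x + 1 = 0 := fun x hx h => by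
    have e : x ^ 4 + a * x ^ 3 + a ^ 2 ^ (t + 1) * x ^ 2 + a * x + 1 =
        x ^ 2 * ((x + x⁻¹ - s) * (x + x⁻¹ - (s + a))) := by
      rw [hs2]; field_simp
      linear_combination (s * x ^ 3 + x ^ 3 * a - x ^ 2 + s * x + x * a) * h2
    rcases h with h | h <;> rw [e, h] <;> simp
  have hls' : l⁻¹ + l⁻¹⁻¹ = s := by rw [hs, inv_inv, add_comm]
  have hms' : m⁻¹ + m⁻¹⁻¹ = s + a := by rw [hs', inv_inv, add_comm]
  have hne : s ≠ s + a := by simpa using ha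
  have d1 : l ≠ l⁻¹ := fun h => hsne (by rw [hs, ← h, CharTwo.add_self_eq_zero])
  have d2 : m ≠ m⁻¹ := fun h => hsne' (by rw [hs', ← h, CharTwo.add_self_eq_zero])
  have d3 : l ≠ m := fun h => hne (by rw [hs', hs, h])
  have d4 : l ≠ m⁻¹ := fun h => hne (by rw [hs', hs, h, inv_inv, add_comm])
  have d5 : l⁻¹ ≠ m := fun h => d4 (by rw [← h, inv_inv])
  have d6 : l⁻¹ ≠ m⁻¹ := fun h => d3 (inv_injective h)
  refine ⟨![l, l⁻¹, m, m⁻¹], ?_, rfl, ?_, n, hn, ?_⟩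
  · intro i j hij
    fin_cases i <;> fin_cases j <;> first | rfl | (exfalso; simp at hij; tauto)
  · intro i
    fin_cases i
    · exact hl
    · exact hroot _ (inv_ne_zero hl0) (Or.inl hls')
    · exact hroot _ hm0 (Or.inr hs'.symm)
    · exact hroot _ (inv_ne_zero hm0) (Or.inr hms')
  · intro i
    fin_cases i <;> simp [hln, hmn]

end Roots

theorem exists_mul_eq_mul_diagonal {n K : Type*} [Fintype n] [DecidableEq n] [Field K]
    {g : Matrix n n K} {d : n → K} (hd : Function.Injective d)
    (hroot : ∀ i, g.charpoly.IsRoot (d i)) :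
    ∃ P : (Matrix n n K)ˣ, g * P = P * diagonal d := by
  have hv : ∀ i, ∃ v : n → K, v ≠ 0 ∧ g *ᵥ v = d i • v := fun i => by
    have h := hroot i
    rw [Polynomial.IsRoot, Matrix.eval_charpoly, ← Matrix.exists_mulVec_eq_zero_iff] at h
    obtain ⟨v, hv, h⟩ := h
    refine ⟨v, hv, ?_⟩
    rw [Matrix.sub_mulVec, sub_eq_zero] at h
    rw [← h]
    simp
  choose v hv0 hgv using hv
  have hli : LinearIndependent K v :=
    Module.End.eigenvectors_linearIndependent' (Matrix.toLin' g) d hd v fun i =>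
      ⟨Module.End.mem_eigenspace_iff.2 (by rw [Matrix.toLin'_apply, hgv]), hv0 i⟩
  have hu : IsUnit (Matrix.of v)ᵀ := Matrix.linearIndependent_cols_iff_isUnit.1 hli
  refine ⟨hu.unit, ?_⟩
  ext i j
  have := congrFun (hgv j) i
  simp [Matrix.mul_apply, Matrix.diagonal_apply, Matrix.mulVec, dotProduct] at this ⊢
  rw [this, mul_comm]

/-! ### Engel words and permutations of eigenlines -/

/-- `A` maps each coordinate line `K e_j` into the coordinate line `K e_(σ j)`. -/
def MapsLines {n K : Type*} [Field K] (σ : n → n) (A : Matrix n n K) : Prop :=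
  ∀ i j, A i j ≠ 0 → i = σ j

namespace MapsLines

variable {n K : Type*} [Field K] {σ τ : n → n} {A B : Matrix n n K}

theorem one [DecidableEq n] : MapsLines id (1 : Matrix n n K) := fun i j h => by
  by_contra hij
  exact h (Matrix.one_apply_ne hij)

theorem diagonal [DecidableEq n] (d : n → K) : MapsLines id (diagonal d) := fun i j h => by
  by_contra hij
  exact h (Matrix.diagonal_apply_ne _ hij)

theorem mul [Fintype n] (hA : MapsLines σ A) (hB : MapsLines τ B) :
    MapsLines (σ ∘ τ) (A * B) := fun i j h => by
  obtain ⟨k, -, hk⟩ := Finset.exists_ne_zero_of_sum_ne_zero h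
  rw [hA i k (left_ne_zero_of_mul hk), hB k j (right_ne_zero_of_mul hk), Function.comp]

theorem pow [Fintype n] [DecidableEq n] (hA : MapsLines σ A) (k : ℕ) : MapsLines σ^[k] (A ^ k) := by
  induction k with
  | zero => simpa using one
  | succ k ih => rw [pow_succ, Function.iterate_succ]; exact ih.mul hA

theorem eq_diagonal [DecidableEq n] (hA : MapsLines id A) : A = Matrix.diagonal A.diag := by
  ext i j
  by_cases hij : i = j
  · subst hij; simp
  · rw [Matrix.diagonal_apply_ne _ hij]
    by_contra h
    exact hij (hA i j h)

/-- A matrix of order prime to `n!` that permutes the `n` coordinate lines fixes each of them. -/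
theorem eq_diagonal_of_pow_eq_one [Fintype n] [DecidableEq n] (hA : MapsLines σ A)
    {m : ℕ} (hm : A ^ m = 1) (hcop : m.Coprime (Fintype.card n).factorial) :
    A = Matrix.diagonal A.diag := by
  have hσ : σ^[m] = id := by
    funext j
    have := hA.pow m j j (by rw [hm]; simp)
    exact this.symm
  have hσ' : σ = id := by
    rcases Nat.eq_zero_or_pos m with rfl | hpos
    · -- here `n! = 1`, so that there is at most one line
      have h1 : Fintype.card n ≤ 1 := by
        rw [Nat.coprime_zero_left] at hcop
        exact Nat.factorial_eq_one.1 hcop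
      have := Fintype.card_le_one_iff_subsingleton.1 h1
      exact Subsingleton.elim _ _
    obtain ⟨k, rfl⟩ := Nat.exists_eq_succ_of_ne_zero hpos.ne'
    let e : Equiv.Perm n :=
      ⟨σ, σ^[k], fun j => congrFun hσ j, fun j => by
        rw [← Function.iterate_succ_apply' σ k j]; exact congrFun hσ j⟩
    have he : e ^ (k + 1) = 1 := Equiv.ext fun j => by
      rw [Equiv.Perm.coe_pow]; exact congrFun hσ j
    have he' : e ^ (Fintype.card n).factorial = 1 := by
      rw [← Fintype.card_perm]; exact pow_card_eq_one
    have : e = 1 := by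
      rw [← orderOf_eq_one_iff, ← Nat.dvd_one, ← hcop]
      exact Nat.dvd_gcd (orderOf_dvd_of_pow_eq_one he) (orderOf_dvd_of_pow_eq_one he')
    exact congrArg DFunLike.coe this
  exact eq_diagonal (hσ' ▸ hA)

end MapsLines

/-- Downward induction along the Engel word: a property that `w` inherits from `[w, y]` passes from
the trivial term back to `x`. -/
theorem EngelEdge.induction {G : Type*} [Group G] {x y : G} (h : EngelEdge x y) {p : G → Prop}
    (h1 : p 1) (hp : ∀ w, p (w⁻¹ * y⁻¹ * w * y) → p w) : p x := by
  obtain ⟨n, -, hn⟩ := h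
  have key : ∀ k ≤ n, p (engelWord x y (n - k)) := fun k => by
    induction k with
    | zero => intro _; rw [Nat.sub_zero, hn]; exact h1
    | succ k ih =>
      intro hk
      have := ih (by omega)
      rw [show n - k = (n - (k + 1)) + 1 by omega] at this
      exact hp _ this
  simpa [engelWord] using key n le_rfl

/-- If `y` acts with distinct eigenvalues, then its centralizer acts as a group of diagonal
matrices, whose normalizer permutes the eigenlines. An element `w` lies in this normalizer as soon
as `[w, y]` does, since the conjugate `w⁻¹ y⁻¹ w` then lies there too, and having order prime to
`n!` it fixes every eigenline. -/
theorem EngelEdge.commute_of_diagonal {G n K : Type*} [Group G] [Fintype n] [DecidableEq n]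
    [Field K] {x y : G} (h : EngelEdge x y) (f : G →* Matrix n n K)
    (hf : Function.Injective f) {d : n → K} (hd : Function.Injective d)
    (hy : f y = diagonal d)
    (hyo : (orderOf y).Coprime (Fintype.card n).factorial)
    (hxo : (orderOf x).Coprime (Fintype.card n).factorial) : Commute x y := by
  have hyi : ∃ d' : n → K, Function.Injective d' ∧ f y⁻¹ = diagonal d' := by
    have hdd : ∀ i, d i ≠ 0 := fun i hi => by
      have h1 : f y * f y⁻¹ = 1 := by rw [← map_mul, mul_inv_cancel, map_one]
      have h2 := congrFun (congrFun h1 i) i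
      rw [hy, Matrix.diagonal_mul, hi, zero_mul, Matrix.one_apply_eq] at h2
      exact zero_ne_one h2
    refine ⟨fun i => (d i)⁻¹, fun i j hij => hd (inv_injective hij), ?_⟩
    have h1 : f y * diagonal (fun i => (d i)⁻¹) = 1 := by
      rw [hy, Matrix.diagonal_mul_diagonal]
      simp [hdd]
    calc f y⁻¹ = f y⁻¹ * (f y * diagonal (fun i => (d i)⁻¹)) := by rw [h1, Matrix.mul_one]
      _ = _ := by rw [← Matrix.mul_assoc, ← map_mul, inv_mul_cancel, map_one, Matrix.one_mul]
  obtain ⟨d', hd', hyi⟩ := hyi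
  have hR : ∃ σ, MapsLines σ (f x) := by
    refine h.induction (p := fun w => ∃ σ, MapsLines σ (f w))
      ⟨id, by rw [map_one]; exact MapsLines.one⟩ ?_
    rintro w ⟨σ, hσ⟩
    have h1 : MapsLines σ (f (w⁻¹ * y⁻¹ * w)) := by
      have := hσ.mul (hyi ▸ MapsLines.diagonal d')
      rwa [← map_mul, mul_inv_cancel_right, Function.comp_id] at this
    have h2 : f (w⁻¹ * y⁻¹ * w) ^ orderOf y = 1 := by
      have e : (w⁻¹ * y⁻¹ * w) ^ orderOf y = 1 := by
        have := conj_pow (a := w⁻¹) (b := y⁻¹) (i := orderOf y)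
        rw [inv_inv] at this
        rw [this, inv_pow, pow_orderOf_eq_one]; simp
      rw [← map_pow, e, map_one]
    have h3 := h1.eq_diagonal_of_pow_eq_one h2 hyo
    generalize (f (w⁻¹ * y⁻¹ * w)).diag = D at h3
    have h4 : f y⁻¹ * f w = f w * diagonal D := by
      rw [← h3, ← map_mul, ← map_mul]; congr 1; group
    rw [hyi] at h4
    have h5 : ∀ i j, f w i j ≠ 0 → d' i = D j := fun i j hij => by
      have := congrFun (congrFun h4 i) j
      rw [Matrix.diagonal_mul, Matrix.mul_diagonal, mul_comm] at this
      exact mul_left_cancel₀ hij this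
    have h6 : ∀ j, ∃ i, ∀ k, f w k j ≠ 0 → k = i := fun j => by
      by_cases hj : ∃ i, f w i j ≠ 0
      · obtain ⟨i, hi⟩ := hj
        exact ⟨i, fun k hk => hd' ((h5 k j hk).trans (h5 i j hi).symm)⟩
      · push Not at hj
        exact ⟨j, fun k hk => absurd (hj k) hk⟩
    choose τ hτ using h6
    exact ⟨τ, fun i j => hτ j i⟩
  obtain ⟨σ, hσ⟩ := hR
  have h3 := hσ.eq_diagonal_of_pow_eq_one
    (by rw [← map_pow, pow_orderOf_eq_one, map_one]) hxo
  apply hf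
  rw [map_mul, map_mul, hy, h3, Matrix.diagonal_mul_diagonal, Matrix.diagonal_mul_diagonal]
  simp only [mul_comm]

/-! ### The Suzuki–Tits ovoid -/

/-- Representatives of the points of the Suzuki–Tits ovoid: one point at infinity and the points
with homogeneous coordinates `(1, x, y, x² θ(x) + x y + θ(y))`. -/
def ovoidPoint (t : ℕ) {F : Type*} [Field F] : Option (F × F) → Fin 4 → F
  | none => ![0, 0, 0, 1]
  | some (x, y) => ![1, x, y, x ^ 2 * suzukiTheta t x + x * y + suzukiTheta t y]

/-- The nonzero vectors that span a point of the Suzuki–Tits ovoid. -/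
def ovoidCone (t : ℕ) (F : Type*) [Field F] : Set (Fin 4 → F) :=
  Set.range fun p : Fˣ × Option (F × F) => (p.1 : F) • ovoidPoint t p.2

section Ovoid

variable {t : ℕ} {F : Type*} [Field F]

theorem ovoidPoint_ne_zero (p : Option (F × F)) : ovoidPoint t p ≠ 0 := by
  intro h
  rcases p with _ | ⟨x, y⟩
  · simpa [ovoidPoint] using congrFun h 3
  · simpa [ovoidPoint] using congrFun h 0

theorem ne_zero_of_mem_ovoidCone {v : Fin 4 → F} (hv : v ∈ ovoidCone t F) : v ≠ 0 := by
  obtain ⟨⟨c, p⟩, rfl⟩ := hv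
  exact smul_ne_zero c.ne_zero (ovoidPoint_ne_zero p)

theorem smul_mem_ovoidCone {c : F} (hc : c ≠ 0) {v : Fin 4 → F} (hv : v ∈ ovoidCone t F) :
    c • v ∈ ovoidCone t F := by
  obtain ⟨⟨k, p⟩, rfl⟩ := hv
  exact ⟨⟨Units.mk0 c hc * k, p⟩, by simp [mul_smul]⟩

theorem ovoidPoint_mem_ovoidCone (p : Option (F × F)) : ovoidPoint t p ∈ ovoidCone t F :=
  ⟨⟨1, p⟩, by simp⟩

theorem mulVec_mem_ovoidCone {g : Matrix (Fin 4) (Fin 4) F}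
    (hg : ∀ p, g *ᵥ ovoidPoint t p ∈ ovoidCone t F) {v : Fin 4 → F} (hv : v ∈ ovoidCone t F) :
    g *ᵥ v ∈ ovoidCone t F := by
  obtain ⟨⟨c, p⟩, rfl⟩ := hv
  simp only [Matrix.mulVec_smul]
  exact smul_mem_ovoidCone c.ne_zero (hg p)

theorem suzukiS_mulVec_none (a b : F) :
    suzukiS t a b *ᵥ ovoidPoint t none = ovoidPoint t none := by
  ext i
  fin_cases i <;> simp [suzukiS, ovoidPoint, Matrix.mulVec, dotProduct, Fin.sum_univ_four]

theorem suzukiS_mulVec_some [CharP F 2] (hF : Nat.card F = 2 ^ (2 * t + 1)) (a b x y : F) :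
    suzukiS t a b *ᵥ ovoidPoint t (some (x, y)) =
      ovoidPoint t (some (a + x, b + suzukiTheta t a * x + y)) := by
  have ha := suzukiTheta_suzukiTheta hF a
  ext i
  fin_cases i <;> simp [suzukiS, ovoidPoint, Matrix.mulVec, dotProduct, Fin.sum_univ_four,
    suzukiTheta_add, suzukiTheta_mul, ha]
  grind

theorem suzukiT_mulVec_none : suzukiT F *ᵥ ovoidPoint t none = ovoidPoint t (some (0, 0)) := by
  ext i
  fin_cases i <;> simp [suzukiT, ovoidPoint, Matrix.mulVec, dotProduct, Fin.sum_univ_four]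

theorem suzukiT_mulVec_mem [CharP F 2] (hF : Nat.card F = 2 ^ (2 * t + 1))
    (p : Option (F × F)) : suzukiT F *ᵥ ovoidPoint t p ∈ ovoidCone t F := by
  rcases p with _ | ⟨x, y⟩
  · rw [suzukiT_mulVec_none]; exact ovoidPoint_mem_ovoidCone _
  have hx := suzukiTheta_suzukiTheta hF x
  have hy := suzukiTheta_suzukiTheta hF y
  obtain ⟨z, hz⟩ : ∃ z, z = x ^ 2 * suzukiTheta t x + x * y + suzukiTheta t y := ⟨_, rfl⟩
  have hzt : suzukiTheta t z = suzukiTheta t x ^ 2 * x ^ 2 + suzukiTheta t x * suzukiTheta t y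
      + y ^ 2 := by
    rw [hz]; simp only [suzukiTheta_add, suzukiTheta_mul, suzukiTheta_pow, hx, hy]
  -- This says that the equation of the ovoid is invariant under reversal of the coordinates.
  have key : z * suzukiTheta t z = x * y * suzukiTheta t z + y ^ 2 * suzukiTheta t y +
      suzukiTheta t x * z ^ 2 := by
    rw [hzt, hz]; grind
  have hT : suzukiT F *ᵥ ovoidPoint t (some (x, y)) = ![z, y, x, 1] := by
    ext i
    fin_cases i <;>
      simp [suzukiT, ovoidPoint, Matrix.mulVec, dotProduct, Fin.sum_univ_four, hz]
  rw [hT]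
  by_cases hz0 : z = 0
  · have hy0 : y = 0 := by
      rw [hz0] at key
      simpa [suzukiTheta_eq_zero_iff] using key
    have hx0 : x = 0 := by
      rw [hz0, hy0] at hz
      simpa [suzukiTheta_eq_zero_iff] using hz
    refine ⟨⟨1, none⟩, ?_⟩
    simp [ovoidPoint, hx0, hy0, hz0]
  · have hzt0 : suzukiTheta t z ≠ 0 := fun h => hz0 (suzukiTheta_eq_zero_iff.1 h)
    refine ⟨⟨Units.mk0 z hz0, some (y / z, x / z)⟩, ?_⟩
    have hlast : z * ((y / z) ^ 2 * suzukiTheta t (y / z) + y / z * (x / z) +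
        suzukiTheta t (x / z)) = 1 := by
      simp only [div_eq_mul_inv, suzukiTheta_mul, suzukiTheta_inv]
      field_simp
      linear_combination -key
    ext i
    fin_cases i
    · simp [ovoidPoint]
    · simp [ovoidPoint, mul_div_cancel₀ _ hz0]
    · simp [ovoidPoint, mul_div_cancel₀ _ hz0]
    · simpa [ovoidPoint] using hlast

theorem suzukiM_mulVec_mem (hF : Nat.card F = 2 ^ (2 * t + 1)) (c : Fˣ)
    (p : Option (F × F)) : suzukiM t c *ᵥ ovoidPoint t p ∈ ovoidCone t F := by
  have hc : (c : F) ≠ 0 := c.ne_zero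
  obtain ⟨k, hk⟩ : ∃ k, k = (c : F) ^ 2 ^ t := ⟨_, rfl⟩
  have hk0 : k ≠ 0 := hk ▸ pow_ne_zero _ hc
  have e : suzukiTheta t k = c := hk ▸ suzukiTheta_pow_two_pow hF (c : F)
  have e' : suzukiTheta t (c : F) = k ^ 2 := by
    rw [suzukiTheta, hk, ← pow_mul, pow_succ]
  rcases p with _ | ⟨x, y⟩
  · refine ⟨⟨Units.mk0 (c * k)⁻¹ (inv_ne_zero (mul_ne_zero hc hk0)), none⟩, ?_⟩
    ext i
    fin_cases i <;> simp [suzukiM, ovoidPoint, Matrix.mulVec, dotProduct, Fin.sum_univ_four,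
      pow_add, ← hk, mul_comm]
  · refine ⟨⟨Units.mk0 (c * k) (mul_ne_zero hc hk0), some (x / c, y / (c * k ^ 2))⟩, ?_⟩
    ext i
    fin_cases i <;> simp [suzukiM, ovoidPoint, Matrix.mulVec, dotProduct, Fin.sum_univ_four,
      pow_add, ← hk, div_eq_mul_inv, suzukiTheta_mul, suzukiTheta_inv, suzukiTheta_pow, e, e'] <;>
      field_simp

theorem card_ovoidCone (hF : Nat.card F = 2 ^ (2 * t + 1)) :
    Nat.card (ovoidCone t F) = (2 ^ (2 * t + 1) - 1) * ((2 ^ (2 * t + 1)) ^ 2 + 1) := by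
  have : Finite F := Nat.finite_of_card_ne_zero (by rw [hF]; positivity)
  have hinj : Function.Injective fun p : Fˣ × Option (F × F) =>
      (p.1 : F) • ovoidPoint t p.2 := by
    rintro ⟨c, p⟩ ⟨c', p'⟩ h
    have h0 := congrFun h 0
    have h1 := congrFun h 1
    have h2 := congrFun h 2
    have h3 := congrFun h 3
    rcases p with _ | ⟨x, y⟩ <;> rcases p' with _ | ⟨x', y'⟩ <;>
      simp [ovoidPoint] at h0 h1 h2 h3
    · exact Prod.ext (Units.ext h3) rfl
    · exact absurd h0.symm c'.ne_zero
    · obtain rfl : c = c' := Units.ext h0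
      rw [mul_left_cancel₀ c.ne_zero h1, mul_left_cancel₀ c.ne_zero h2]
  rw [ovoidCone, Nat.card_range_of_injective hinj, Nat.card_prod, Nat.card_units,
    Finite.card_option, Nat.card_prod, hF, sq]

end Ovoid

theorem isSuzukiMatrix_and_mulVec_mem {t : ℕ} {F : Type*} [Field F] [CharP F 2]
    (hF : Nat.card F = 2 ^ (2 * t + 1)) {g : SpecialLinearGroup (Fin 4) F}
    (hg : g ∈ suzukiGroup t F) :
    IsSuzukiMatrix t g.1 ∧ ∀ v ∈ ovoidCone t F, g.1 *ᵥ v ∈ ovoidCone t F := by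
  have : Finite F := Nat.finite_of_card_ne_zero (by rw [hF]; positivity)
  have : Finite (SpecialLinearGroup (Fin 4) F) := Subtype.finite
  -- In a finite group the subgroup and the submonoid generated by a set agree.
  rw [suzukiGroup, ← Subgroup.mem_toSubmonoid, Subgroup.closure_toSubmonoid_of_finite] at hg
  induction hg using Submonoid.closure_induction with
  | mem g hg =>
    rcases hg with (⟨p, rfl⟩ | ⟨c, rfl⟩) | rfl
    · refine ⟨.suzukiS hF _ _, fun v hv => mulVec_mem_ovoidCone ?_ hv⟩
      rintro (_ | ⟨x, y⟩)
      · rw [suzukiS_mulVec_none]; exact ovoidPoint_mem_ovoidCone _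
      · rw [suzukiS_mulVec_some hF]; exact ovoidPoint_mem_ovoidCone _
    · exact ⟨.suzukiM hF _, fun v hv => mulVec_mem_ovoidCone (suzukiM_mulVec_mem hF c) hv⟩
    · exact ⟨.suzukiT, fun v hv => mulVec_mem_ovoidCone (suzukiT_mulVec_mem hF) hv⟩
  | one => exact ⟨.one, fun v hv => by simpa using hv⟩
  | mul g h _ _ hg hh =>
    refine ⟨hg.1.mul hh.1, fun v hv => ?_⟩
    have := hg.2 _ (hh.2 v hv)
    rwa [Matrix.mulVec_mulVec] at this

/-! ### Elements of the Suzuki group -/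

theorem IsSuzukiMatrix.eq_one_of_mulVec_eq {t : ℕ} {F : Type*} [Field F]
    {g : Matrix (Fin 4) (Fin 4) F} (h : IsSuzukiMatrix t g)
    (h0 : g *ᵥ ovoidPoint t (some (0, 0)) = ovoidPoint t (some (0, 0)))
    (h3 : g *ᵥ ovoidPoint t none = ovoidPoint t none) : g = 1 := by
  have c0 : ∀ i, g i 0 = (1 : Matrix (Fin 4) (Fin 4) F) i 0 := fun i => by
    have := congrFun h0 i
    fin_cases i <;>
      simpa [ovoidPoint, Matrix.mulVec, dotProduct, Fin.sum_univ_four, Matrix.one_apply] using this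
  have c3 : ∀ i, g i 3 = (1 : Matrix (Fin 4) (Fin 4) F) i 3 := fun i => by
    have := congrFun h3 i
    fin_cases i <;>
      simpa [ovoidPoint, Matrix.mulVec, dotProduct, Fin.sum_univ_four, Matrix.one_apply] using this
  have hm := h.minor
  simp only [pairMinor] at hm
  have m00 := hm 0 0
  have m01 := hm 0 1
  have m02 := hm 0 2
  have m10 := hm 1 0
  have m11 := hm 1 1
  have m12 := hm 1 2
  have m31 := hm 3 1
  have m32 := hm 3 2
  simp only [sectionPair, Matrix.cons_val, c0, c3] at m00 m01 m02 m10 m11 m12 m31 m32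
  simp at m00 m01 m02 m10 m11 m12 m31 m32
  have z02 := suzukiTheta_eq_zero_iff.1 m02.symm
  have z12 := suzukiTheta_eq_zero_iff.1 m12.symm
  have z31 := suzukiTheta_eq_zero_iff.1 m31.symm
  have z01 := suzukiTheta_eq_zero_iff.1 (m01.symm.trans z12)
  have z32 := suzukiTheta_eq_zero_iff.1 (m32.symm.trans m10)
  rw [m00, suzukiTheta_one] at m11
  ext i j
  fin_cases j
  · exact c0 i
  · fin_cases i <;> simp [m00, m10, z01, z31]
  · fin_cases i <;> simp [m11, z02, z12, z32]
  · exact c3 i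

/-- The inclusion of the Suzuki group into the ring of `4 × 4` matrices. -/
def suzukiToMatrix (t : ℕ) (F : Type*) [Field F] : suzukiGroup t F →* Matrix (Fin 4) (Fin 4) F where
  toFun g := g.1.1
  map_one' := rfl
  map_mul' _ _ := rfl

section Group

variable {t : ℕ} {F : Type*} [Field F]

theorem suzukiToMatrix_injective : Function.Injective (suzukiToMatrix t F) := fun _ _ h =>
  Subtype.ext (Subtype.ext h)

theorem det_suzukiToMatrix (g : suzukiGroup t F) : (suzukiToMatrix t F g).det = 1 := g.1.2

theorem isSuzukiMatrix_suzukiToMatrix [CharP F 2] (hF : Nat.card F = 2 ^ (2 * t + 1))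
    (g : suzukiGroup t F) : IsSuzukiMatrix t (suzukiToMatrix t F g) :=
  (isSuzukiMatrix_and_mulVec_mem hF g.2).1

theorem suzukiToMatrix_mulVec_mem [CharP F 2] (hF : Nat.card F = 2 ^ (2 * t + 1))
    (g : suzukiGroup t F) {v : Fin 4 → F} (hv : v ∈ ovoidCone t F) :
    suzukiToMatrix t F g *ᵥ v ∈ ovoidCone t F :=
  (isSuzukiMatrix_and_mulVec_mem hF g.2).2 v hv

theorem pow_four_eq_one_of_trace_eq_zero [CharP F 2] (hF : Nat.card F = 2 ^ (2 * t + 1))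
    {g : suzukiGroup t F} (hg : (suzukiToMatrix t F g).trace = 0) : g ^ 4 = 1 :=
  suzukiToMatrix_injective <| by
    rw [map_pow, map_one]
    exact (isSuzukiMatrix_suzukiToMatrix hF g).pow_four_eq_one (det_suzukiToMatrix g) hg

theorem pow_four_eq_one_of_mulVec_eq [CharP F 2] (hF : Nat.card F = 2 ^ (2 * t + 1))
    {g : suzukiGroup t F} {v : Fin 4 → F} (hv : v ≠ 0) (hgv : suzukiToMatrix t F g *ᵥ v = v) :
    g ^ 4 = 1 :=
  pow_four_eq_one_of_trace_eq_zero hF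
    ((isSuzukiMatrix_suzukiToMatrix hF g).trace_eq_zero_of_mulVec_eq (det_suzukiToMatrix g) hv hgv)

/-- An element of nonzero trace is diagonalizable with distinct eigenvalues over an algebraically
closed field, and its order divides a torus order. -/
theorem exists_hom_eq_diagonal {K : Type*} [Field K] [IsAlgClosed K] [Algebra F K] [CharP F 2]
    (hF : Nat.card F = 2 ^ (2 * t + 1)) {g : suzukiGroup t F}
    (hg : (suzukiToMatrix t F g).trace ≠ 0) {l : K}
    (hl : Polynomial.aeval l (suzukiToMatrix t F g).charpoly = 0) :
    ∃ f : suzukiGroup t F →* Matrix (Fin 4) (Fin 4) K, Function.Injective f ∧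
      ∃ d : Fin 4 → K, Function.Injective d ∧ f g = diagonal d ∧
        ∃ n ∈ torusOrders t, g ^ n = 1 ∧ l ^ n = 1 := by
  have hK : CharP K 2 := charP_of_injective_algebraMap (algebraMap F K).injective 2
  have hchar := (isSuzukiMatrix_suzukiToMatrix hF g).charpoly (det_suzukiToMatrix g)
  have heval : ∀ x : K, Polynomial.aeval x (suzukiToMatrix t F g).charpoly =
      x ^ 4 + algebraMap F K (suzukiToMatrix t F g).trace * x ^ 3 +
      algebraMap F K (suzukiToMatrix t F g).trace ^ 2 ^ (t + 1) * x ^ 2 +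
      algebraMap F K (suzukiToMatrix t F g).trace * x + 1 := fun x => by
    rw [hchar]; simp [suzukiTheta]
  obtain ⟨d, hd, hd0, hroot, n, hn, hdn⟩ := exists_distinct_roots (t := t)
    (a := algebraMap F K (suzukiToMatrix t F g).trace) (l := l)
    (by simpa using hg) (by rw [← map_pow, pow_card_eq hF]) (by rw [← heval, hl])
  obtain ⟨P, hP⟩ := exists_mul_eq_mul_diagonal
    (g := (suzukiToMatrix t F g).map (algebraMap F K)) hd (fun i => by
      rw [Matrix.charpoly_map, Polynomial.IsRoot, Polynomial.eval_map_algebraMap, heval, hroot])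
  let f : suzukiGroup t F →* Matrix (Fin 4) (Fin 4) K :=
    { toFun := fun h => P⁻¹.val * (suzukiToMatrix t F h).map (algebraMap F K) * P.val
      map_one' := by simp
      map_mul' := fun h k => by
        rw [map_mul, Matrix.map_mul]
        simp only [mul_assoc, Units.mul_inv_cancel_left] }
  have hf : Function.Injective f := fun h k hhk => by
    have h1 : P⁻¹.val * (suzukiToMatrix t F h).map (algebraMap F K) * P.val =
        P⁻¹.val * (suzukiToMatrix t F k).map (algebraMap F K) * P.val := hhk
    have h2 := P⁻¹.isUnit.mul_left_cancel (P.isUnit.mul_right_cancel h1)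
    exact suzukiToMatrix_injective (Matrix.map_injective (algebraMap F K).injective h2)
  have hfg : f g = diagonal d := by
    change P⁻¹.val * (suzukiToMatrix t F g).map (algebraMap F K) * P.val = diagonal d
    rw [mul_assoc, hP, Units.inv_mul_cancel_left]
  refine ⟨f, hf, d, hd, hfg, n, hn, hf ?_, hd0 ▸ hdn 0⟩
  rw [map_pow, hfg, Matrix.diagonal_pow, map_one, ← Matrix.diagonal_one]
  exact congrArg _ (funext hdn)

theorem exists_hom_eq_diagonal' [CharP F 2]
    (hF : Nat.card F = 2 ^ (2 * t + 1)) {g : suzukiGroup t F}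
    (hg : (suzukiToMatrix t F g).trace ≠ 0) :
    ∃ f : suzukiGroup t F →* Matrix (Fin 4) (Fin 4) (AlgebraicClosure F), Function.Injective f ∧
      ∃ d : Fin 4 → AlgebraicClosure F, Function.Injective d ∧ f g = diagonal d ∧
        ∃ n ∈ torusOrders t, g ^ n = 1 := by
  obtain ⟨l, hl⟩ := IsAlgClosed.exists_aeval_eq_zero (AlgebraicClosure F)
    (suzukiToMatrix t F g).charpoly (by
      rw [Matrix.charpoly_degree_eq_dim]; simp)
  obtain ⟨f, hf, d, hd, hfg, n, hn, hgn, -⟩ := exists_hom_eq_diagonal hF hg hl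
  exact ⟨f, hf, d, hd, hfg, n, hn, hgn⟩

/-- The order of an element of the Suzuki group divides `4` or a torus order. -/
theorem pow_four_eq_one_or_exists_torusOrder [CharP F 2] (hF : Nat.card F = 2 ^ (2 * t + 1))
    (g : suzukiGroup t F) : g ^ 4 = 1 ∨ ∃ n ∈ torusOrders t, g ^ n = 1 := by
  by_cases hg : (suzukiToMatrix t F g).trace = 0
  · exact Or.inl (pow_four_eq_one_of_trace_eq_zero hF hg)
  · obtain ⟨-, -, -, -, -, h⟩ := exists_hom_eq_diagonal' hF hg
    exact Or.inr h

/-- The Suzuki–Tits ovoid has an odd number of points, so a `2`-element fixes one. -/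
theorem exists_mulVec_eq_of_pow_four_eq_one [CharP F 2] (hF : Nat.card F = 2 ^ (2 * t + 1))
    {g : suzukiGroup t F} (hg : g ^ 4 = 1) :
    ∃ v ∈ ovoidCone t F, suzukiToMatrix t F g *ᵥ v = v := by
  classical
  have : Finite F := Nat.finite_of_card_ne_zero (by rw [hF]; positivity)
  have := Fintype.ofFinite (ovoidCone t F)
  let act : suzukiGroup t F →* Function.End (ovoidCone t F) :=
    { toFun := fun h v => ⟨suzukiToMatrix t F h *ᵥ v.1, suzukiToMatrix_mulVec_mem hF h v.2⟩
      map_one' := by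
        funext v
        refine Subtype.ext ?_
        change suzukiToMatrix t F 1 *ᵥ v.1 = v.1
        rw [map_one, Matrix.one_mulVec]
      map_mul' := fun h k => by
        funext v
        refine Subtype.ext ?_
        change suzukiToMatrix t F (h * k) *ᵥ v.1 =
          suzukiToMatrix t F h *ᵥ (suzukiToMatrix t F k *ᵥ v.1)
        rw [map_mul, Matrix.mulVec_mulVec] }
  have hmod := Equiv.Perm.card_fixedPoints_modEq (f := act g) (p := 2) (n := 2)
    (by rw [← map_pow]; norm_num [hg])
  have hodd : Fintype.card (ovoidCone t F) % 2 = 1 := by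
    rw [← Nat.card_eq_fintype_card, card_ovoidCone hF, ← Nat.odd_iff]
    have he : Even (2 ^ (2 * t + 1)) := (even_two).pow_of_ne_zero (by omega)
    exact (Nat.Even.sub_odd Nat.one_le_two_pow he odd_one).mul
      (he.pow_of_ne_zero two_ne_zero).add_one
  have hne : Fintype.card (Function.fixedPoints (act g)) ≠ 0 := fun h => by
    rw [Nat.ModEq, h, hodd] at hmod
    norm_num at hmod
  obtain ⟨⟨v, hv⟩⟩ := Fintype.card_pos_iff.1 (Nat.pos_of_ne_zero hne)
  exact ⟨v.1, v.2, congrArg Subtype.val hv⟩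

/-- The element of the Suzuki group with matrix `S(a, b)`. -/
def suzukiGroupS (t : ℕ) {F : Type*} [Field F] (a b : F) : suzukiGroup t F :=
  ⟨⟨suzukiS t a b, det_suzukiS t a b⟩, Subgroup.subset_closure (Or.inl (Or.inl ⟨(a, b), rfl⟩))⟩

/-- The element of the Suzuki group with antidiagonal permutation matrix. -/
def suzukiGroupT (t : ℕ) (F : Type*) [Field F] : suzukiGroup t F :=
  ⟨⟨suzukiT F, det_suzukiT⟩, Subgroup.subset_closure (Or.inr rfl)⟩

@[simp] theorem suzukiToMatrix_suzukiGroupS (a b : F) :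
    suzukiToMatrix t F (suzukiGroupS t a b) = suzukiS t a b := rfl

@[simp] theorem suzukiToMatrix_suzukiGroupT :
    suzukiToMatrix t F (suzukiGroupT t F) = suzukiT F := rfl

theorem suzukiGroupS_mulVec_zero [CharP F 2] (hF : Nat.card F = 2 ^ (2 * t + 1)) (a b : F) :
    suzukiToMatrix t F (suzukiGroupS t a b) *ᵥ ovoidPoint t (some (0, 0)) =
      ovoidPoint t (some (a, b)) := by
  rw [suzukiToMatrix_suzukiGroupS, suzukiS_mulVec_some hF]
  simp

/-- The Suzuki group is transitive on the points of the ovoid. -/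
theorem exists_mulVec_none_eq [CharP F 2] (hF : Nat.card F = 2 ^ (2 * t + 1))
    (p : Option (F × F)) :
    ∃ h : suzukiGroup t F, suzukiToMatrix t F h *ᵥ ovoidPoint t none = ovoidPoint t p := by
  rcases p with _ | ⟨x, y⟩
  · exact ⟨1, by simp⟩
  · refine ⟨suzukiGroupS t x y * suzukiGroupT t F, ?_⟩
    rw [map_mul, ← Matrix.mulVec_mulVec, suzukiToMatrix_suzukiGroupT, suzukiT_mulVec_none,
      suzukiGroupS_mulVec_zero hF]

theorem inv_mulVec_eq {g : suzukiGroup t F} {u v : Fin 4 → F}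
    (h : suzukiToMatrix t F g *ᵥ u = v) : suzukiToMatrix t F g⁻¹ *ᵥ v = u := by
  rw [← h, Matrix.mulVec_mulVec, ← map_mul, inv_mul_cancel, map_one, Matrix.one_mulVec]

theorem conj_mulVec_eq {g h : suzukiGroup t F} {u v : Fin 4 → F}
    (hu : suzukiToMatrix t F h *ᵥ u = v) (hv : suzukiToMatrix t F g *ᵥ v = v) :
    suzukiToMatrix t F (h⁻¹ * g * h) *ᵥ u = u := by
  rw [map_mul, map_mul, ← Matrix.mulVec_mulVec, ← Matrix.mulVec_mulVec, hu, hv, inv_mulVec_eq hu]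

/-- A nontrivial element fixes the vectors of at most one point of the ovoid: two points can be
moved to the first and the last coordinate line, and the equations of the Suzuki group then leave
only the identity. -/
theorem exists_eq_smul_of_mulVec_eq [CharP F 2] (hF : Nat.card F = 2 ^ (2 * t + 1))
    {g : suzukiGroup t F} (hg : g ≠ 1) {u v : Fin 4 → F} (hu : u ∈ ovoidCone t F)
    (hv : v ∈ ovoidCone t F) (hgu : suzukiToMatrix t F g *ᵥ u = u)
    (hgv : suzukiToMatrix t F g *ᵥ v = v) : ∃ c : F, v = c • u := by
  have hcancel : ∀ (A : Matrix (Fin 4) (Fin 4) F) (c : Fˣ) (w : Fin 4 → F),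
      A *ᵥ ((c : F) • w) = (c : F) • w → A *ᵥ w = w := fun A c w h => by
    rw [Matrix.mulVec_smul] at h
    exact smul_right_injective _ c.ne_zero h
  obtain ⟨⟨c, p⟩, rfl⟩ := hu
  obtain ⟨h, hh⟩ := exists_mulVec_none_eq hF p
  have h1 := conj_mulVec_eq hh (hcancel _ _ _ hgu)
  have hv' := suzukiToMatrix_mulVec_mem hF h⁻¹ hv
  obtain ⟨⟨k, p'⟩, hk⟩ := hv'
  have hvk : suzukiToMatrix t F h *ᵥ ((k : F) • ovoidPoint t p') = v := by
    have := inv_mulVec_eq hk.symm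
    rwa [inv_inv] at this
  have h2 := hcancel _ _ _ (conj_mulVec_eq hvk hgv)
  rcases p' with _ | ⟨x, y⟩
  · refine ⟨k * (c : F)⁻¹, ?_⟩
    rw [← hvk, Matrix.mulVec_smul, hh, smul_smul, mul_assoc, inv_mul_cancel₀ c.ne_zero, mul_one]
  · exfalso
    have h3 := conj_mulVec_eq (suzukiGroupS_mulVec_zero hF x y) h2
    have h4 := conj_mulVec_eq (h := suzukiGroupS t x y) (suzukiS_mulVec_none x y) h1
    have h5 := suzukiToMatrix_injective
      (((isSuzukiMatrix_suzukiToMatrix hF _).eq_one_of_mulVec_eq h3 h4).trans (map_one _).symm)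
    apply hg
    have h6 := conj_eq_one_iff (a := (suzukiGroupS t x y)⁻¹) (b := h⁻¹ * g * h)
    have h7 := conj_eq_one_iff (a := h⁻¹) (b := g)
    rw [inv_inv] at h6 h7
    exact h7.1 (h6.1 h5)

theorem eq_one_of_pow_eq_one_of_coprime {G : Type*} [Monoid G] {x : G} {m n : ℕ}
    (hm : x ^ m = 1) (hn : x ^ n = 1) (h : m.Coprime n) : x = 1 := by
  rw [← orderOf_eq_one_iff, ← Nat.dvd_one, ← h]
  exact Nat.dvd_gcd (orderOf_dvd_of_pow_eq_one hm) (orderOf_dvd_of_pow_eq_one hn)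

/-- A nontrivial `2`-element `y` fixes exactly one point `p` of the ovoid, and `w` fixes `p` as soon
as `[w, y]` does. Hence `x ↦ y` forces `x` to fix `p`, which a nontrivial element of order dividing
`q + √(2q) + 1` cannot do, as this number is prime to `4` and to `q - 1`. -/
theorem EngelEdge.eq_one_of_pow_four_eq_one [CharP F 2] (hF : Nat.card F = 2 ^ (2 * t + 1))
    {x y : suzukiGroup t F} (h : EngelEdge x y) (hy : y ^ 4 = 1) (hy1 : y ≠ 1)
    (hx : x ^ (2 ^ (2 * t + 1) + 2 ^ (t + 1) + 1) = 1) : x = 1 := by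
  have hN : 2 ^ (2 * t + 1) + 2 ^ (t + 1) + 1 ∈ torusOrders t := Or.inr (Or.inr rfl)
  have hNq : (2 ^ (2 * t + 1) + 2 ^ (t + 1) + 1).Coprime (2 ^ (2 * t + 1) - 1) :=
    coprime_torusOrders (Or.inl rfl) (by
      have := Nat.sub_le (2 ^ (2 * t + 1)) 1
      have : 0 < 2 ^ (t + 1) := by positivity
      omega)
  obtain ⟨p, hp, hyp⟩ := exists_mulVec_eq_of_pow_four_eq_one hF hy
  have hp0 := ne_zero_of_mem_ovoidCone hp
  have hyi : (y⁻¹) ^ 4 = 1 := by rw [inv_pow, hy, inv_one]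
  -- An eigenvalue in `F` of an element of order prime to `q - 1` is `1`.
  have heig : ∀ (g : suzukiGroup t F) (m : ℕ) (u : Fin 4 → F) (c : F), u ≠ 0 → g ^ m = 1 →
      m.Coprime (2 ^ (2 * t + 1) - 1) → suzukiToMatrix t F g *ᵥ u = c • u → c = 1 := by
    intro g m u c hu hgm hm hgu
    have hpow : ∀ k : ℕ, suzukiToMatrix t F (g ^ k) *ᵥ u = c ^ k • u := fun k => by
      induction k with
      | zero => simp
      | succ k ih =>
        rw [pow_succ, map_mul, ← Matrix.mulVec_mulVec, hgu, Matrix.mulVec_smul, ih, smul_smul,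
          pow_succ, mul_comm]
    have hcm : c ^ m = 1 := by
      have := hpow m
      rw [hgm, map_one, Matrix.one_mulVec] at this
      obtain ⟨i, hi⟩ := Function.ne_iff.1 hu
      have h1 := congrFun this i
      rw [Pi.smul_apply, smul_eq_mul] at h1
      exact mul_right_cancel₀ hi (by rw [← h1, one_mul])
    have hc0 : c ≠ 0 := by
      rintro rfl
      have h2 : suzukiToMatrix t F g⁻¹ *ᵥ (suzukiToMatrix t F g *ᵥ u) = u := inv_mulVec_eq rfl
      rw [hgu, zero_smul, Matrix.mulVec_zero] at h2
      exact hu h2.symm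
    have hcq : c ^ (2 ^ (2 * t + 1) - 1) = 1 := by
      rw [pow_sub₀ c hc0 Nat.one_le_two_pow, pow_card_eq hF, pow_one, mul_inv_cancel₀ hc0]
    exact eq_one_of_pow_eq_one_of_coprime hcm hcq hm
  have h4 : (4 : ℕ).Coprime (2 ^ (2 * t + 1) - 1) :=
    (coprime_two_of_mem_torusOrders (t := t) (Or.inl rfl)).symm.pow_left 2
  have hxp : ∃ c : F, suzukiToMatrix t F x *ᵥ p = c • p := by
    refine h.induction (p := fun w => ∃ c : F, suzukiToMatrix t F w *ᵥ p = c • p) ⟨1, by simp⟩ ?_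
    rintro w ⟨c, hc⟩
    rw [map_mul, ← Matrix.mulVec_mulVec, hyp] at hc
    have hc1 : c = 1 := by
      refine heig (w⁻¹ * y⁻¹ * w) 4 p c hp0 ?_ h4 hc
      have := conj_pow (a := w⁻¹) (b := y⁻¹) (i := 4)
      rw [inv_inv] at this
      rw [this, hyi]; simp
    rw [hc1, one_smul] at hc
    have h1 : suzukiToMatrix t F y⁻¹ *ᵥ (suzukiToMatrix t F w *ᵥ p) =
        suzukiToMatrix t F w *ᵥ p := by
      rw [map_mul, map_mul, ← Matrix.mulVec_mulVec, ← Matrix.mulVec_mulVec] at hc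
      have := inv_mulVec_eq hc
      rw [inv_inv] at this
      exact this.symm
    exact exists_eq_smul_of_mulVec_eq hF (inv_ne_one.2 hy1) hp (suzukiToMatrix_mulVec_mem hF w hp)
      (inv_mulVec_eq hyp) h1
  obtain ⟨c, hc⟩ := hxp
  have hc1 := heig x _ p c hp0 hx hNq hc
  rw [hc1, one_smul] at hc
  exact eq_one_of_pow_eq_one_of_coprime hx (pow_four_eq_one_of_mulVec_eq hF hp0 hc)
    ((coprime_two_of_mem_torusOrders hN).pow_right 2)

/-- Let `x ≠ 1` have order dividing `q + √(2q) + 1`, and let `y` commute with `x`. If the order of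
`y ≠ 1` divided another torus order, then the order of `x y` would be a product of nontrivial divisors
of these two coprime torus orders, and such a product divides neither `4` nor a torus order. -/
theorem pow_eq_one_of_commute [CharP F 2] (hF : Nat.card F = 2 ^ (2 * t + 1))
    {x y : suzukiGroup t F} (h : Commute x y) (hx1 : x ≠ 1)
    (hx : x ^ (2 ^ (2 * t + 1) + 2 ^ (t + 1) + 1) = 1) {n : ℕ} (hn : n ∈ torusOrders t)
    (hy : y ^ n = 1) : y ^ (2 ^ (2 * t + 1) + 2 ^ (t + 1) + 1) = 1 := by
  by_cases hne : n = 2 ^ (2 * t + 1) + 2 ^ (t + 1) + 1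
  · rwa [hne] at hy
  have hcop := coprime_torusOrders hn hne
  have hco : (orderOf x).Coprime (orderOf y) :=
    Nat.Coprime.of_dvd (orderOf_dvd_of_pow_eq_one hx) (orderOf_dvd_of_pow_eq_one hy) hcop
  have hmul := h.orderOf_mul_eq_mul_orderOf_of_coprime hco
  have hsplit : ∀ m, (x * y) ^ m = 1 → x ^ m = 1 ∧ y ^ m = 1 := fun m hm => by
    have := orderOf_dvd_of_pow_eq_one hm
    rw [hmul] at this
    exact ⟨orderOf_dvd_iff_pow_eq_one.1 (dvd_of_mul_right_dvd this),
      orderOf_dvd_iff_pow_eq_one.1 (dvd_of_mul_left_dvd this)⟩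
  rcases pow_four_eq_one_or_exists_torusOrder hF (x * y) with h4 | ⟨m, hm, hxy⟩
  · exact absurd (eq_one_of_pow_eq_one_of_coprime hx (hsplit 4 h4).1
      ((coprime_two_of_mem_torusOrders (t := t) (Or.inr (Or.inr rfl))).pow_right 2)) hx1
  · by_cases hmne : m = 2 ^ (2 * t + 1) + 2 ^ (t + 1) + 1
    · exact hmne ▸ (hsplit m hxy).2
    · exact absurd (eq_one_of_pow_eq_one_of_coprime hx (hsplit m hxy).1
        (coprime_torusOrders hm hmne)) hx1

theorem EngelEdge.pow_eq_one [CharP F 2] (hF : Nat.card F = 2 ^ (2 * t + 1))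
    {x y : suzukiGroup t F} (h : EngelEdge x y) (hx1 : x ≠ 1)
    (hx : x ^ (2 ^ (2 * t + 1) + 2 ^ (t + 1) + 1) = 1) :
    y ^ (2 ^ (2 * t + 1) + 2 ^ (t + 1) + 1) = 1 := by
  by_cases hy1 : y = 1
  · rw [hy1, one_pow]
  by_cases hy : (suzukiToMatrix t F y).trace = 0
  · exact absurd
      (h.eq_one_of_pow_four_eq_one hF (pow_four_eq_one_of_trace_eq_zero hF hy) hy1 hx) hx1
  · obtain ⟨f, hf, d, hd, hfy, n, hn, hyn⟩ := exists_hom_eq_diagonal' hF hy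
    refine pow_eq_one_of_commute hF (h.commute_of_diagonal f hf hd hfy ?_ ?_) hx1 hx hn hyn
    · exact (coprime_of_mem_torusOrders hn).coprime_dvd_left (orderOf_dvd_of_pow_eq_one hyn)
    · exact (coprime_of_mem_torusOrders (t := t) (Or.inr (Or.inr rfl))).coprime_dvd_left
        (orderOf_dvd_of_pow_eq_one hx)

end Group

/-! ### Elements of order dividing `q + √(2q) + 1` and the Engel graph -/

theorem hypercenter_eq_bot_of_center_eq_bot {G : Type*} [Group G]
    (h : Subgroup.center G = ⊥) : hypercenter G = ⊥ := by
  have key : ∀ n, Subgroup.upperCentralSeries G n = ⊥ := fun n => by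
    induction n with
    | zero => exact Subgroup.upperCentralSeries_zero G
    | succ n ih =>
      rw [eq_bot_iff]
      intro x hx
      rw [Subgroup.mem_upperCentralSeries_succ_iff, ih] at hx
      rw [← h, Subgroup.mem_center_iff]
      intro y
      have := Subgroup.mem_bot.1 (hx y)
      rw [commutatorElement_def, mul_inv_eq_one, mul_inv_eq_iff_eq_mul] at this
      exact this.symm
  simp [hypercenter, key]

theorem mem_range_algebraMap_of_pow_eq {t : ℕ} {F : Type*} [Field F]
    (hF : Nat.card F = 2 ^ (2 * t + 1)) {K : Type*} [Field K] [Algebra F K] {a : K}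
    (ha : a ^ 2 ^ (2 * t + 1) = a) : a ∈ (algebraMap F K).range := by
  have : Finite F := Nat.finite_of_card_ne_zero (by rw [hF]; positivity)
  have := Fintype.ofFinite F
  have hq : 1 < 2 ^ (2 * t + 1) := Nat.one_lt_two_pow (by omega)
  have hcard : Fintype.card F = 2 ^ (2 * t + 1) := by rw [← hF, Nat.card_eq_fintype_card]
  have hroots := FiniteField.roots_X_pow_card_sub_X F
  rw [hcard] at hroots
  have hs : (Polynomial.X ^ 2 ^ (2 * t + 1) - Polynomial.X : Polynomial F).Splits := by
    rw [Polynomial.splits_iff_card_roots, hroots,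
      FiniteField.X_pow_card_sub_X_natDegree_eq F hq, ← hcard]
    rfl
  exact hs.mem_range_of_isRoot (FiniteField.X_pow_card_sub_X_ne_zero F hq) (by simp [ha])

/-- A primitive root of unity `l` of order `q + √(2q) + 1` is an eigenvalue of the matrix
`T S(0, b)` for a suitable `b`: its conjugates over the field with `q` elements are `l ^ ±1` and
`l ^ ±(√(2q) + 1)`, and the trace of `T S(0, b)` takes every value. -/
theorem exists_ne_one_pow_eq_one_of_isAlgClosed {t : ℕ} {F : Type*} [Field F] [CharP F 2]
    (hF : Nat.card F = 2 ^ (2 * t + 1)) (K : Type*) [Field K] [IsAlgClosed K] [Algebra F K] :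
    ∃ x : suzukiGroup t F, x ≠ 1 ∧ x ^ (2 ^ (2 * t + 1) + 2 ^ (t + 1) + 1) = 1 := by
  have hK : CharP K 2 := charP_of_injective_algebraMap (algebraMap F K).injective 2
  have h2 : (2 : K) = 0 := CharTwo.two_eq_zero
  have hN : 2 ^ (2 * t + 1) + 2 ^ (t + 1) + 1 ∈ torusOrders t := Or.inr (Or.inr rfl)
  have hNK : NeZero ((2 ^ (2 * t + 1) + 2 ^ (t + 1) + 1 : ℕ) : K) := ⟨by push_cast; simp [h2]⟩
  obtain ⟨l, hl⟩ := HasEnoughRootsOfUnity.exists_primitiveRoot K (2 ^ (2 * t + 1) + 2 ^ (t + 1) + 1)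
  have hl0 : l ≠ 0 := hl.ne_zero (by omega)
  have hl1 : l ≠ 1 := fun h => by
    have := hl.unique (h ▸ IsPrimitiveRoot.one)
    have : 0 < 2 ^ (t + 1) := by positivity
    omega
  have hlN := hl.pow_eq_one
  obtain ⟨m, hm⟩ : ∃ m, m = l ^ (2 ^ (t + 1) + 1) := ⟨_, rfl⟩
  have hm0 : m ≠ 0 := hm ▸ pow_ne_zero _ hl0
  have hlr : l ^ 2 ^ (t + 1) = m * l⁻¹ := by
    rw [hm, pow_succ l (2 ^ (t + 1)), mul_inv_cancel_right₀ hl0]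
  have hlq : l ^ 2 ^ (2 * t + 1) = m⁻¹ := by
    apply eq_inv_of_mul_eq_one_left
    rw [hm, ← pow_add, ← add_assoc, hlN]
  have hlrr : (m * l⁻¹) ^ 2 ^ (t + 1) = (m ^ 2)⁻¹ := by
    rw [← hlr, ← pow_mul, two_pow_mul_self_eq, mul_comm 2, pow_mul, hlq, inv_pow]
  have hmr : m ^ 2 ^ (t + 1) = (m * l)⁻¹ := by
    have : m ^ 2 ^ (t + 1) = (m * l⁻¹) ^ 2 ^ (t + 1) * l ^ 2 ^ (t + 1) := by
      rw [← mul_pow]; field_simp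
    rw [this, hlrr, hlr]; field_simp
  have hmq : m ^ 2 ^ (2 * t + 1) = l := by
    rw [hm, pow_right_comm, hlq, inv_pow, pow_succ, hmr]; field_simp
  obtain ⟨a, ha⟩ : ∃ a, a = l + l⁻¹ + m + m⁻¹ := ⟨_, rfl⟩
  have haq : a ^ 2 ^ (2 * t + 1) = a := by
    rw [ha]; simp only [add_pow_char_pow, inv_pow, hlq, hmq, inv_inv]; ring
  have har : a ^ 2 ^ (t + 1) = (l + l⁻¹) * (m + m⁻¹) := by
    rw [ha]; simp only [add_pow_char_pow, inv_pow, hlr, hmr]; field_simp; ring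
  obtain ⟨b, hb⟩ := mem_range_algebraMap_of_pow_eq hF haq
  let g : suzukiGroup t F := suzukiGroupT t F * suzukiGroupS t 0 (b ^ 2 ^ t)
  have htr : (suzukiToMatrix t F g).trace = b := by
    simp only [g, map_mul, suzukiToMatrix_suzukiGroupT, suzukiToMatrix_suzukiGroupS]
    simp [suzukiT, suzukiS, Matrix.trace, Fin.sum_univ_four,
      suzukiTheta_pow_two_pow hF]
  have hroot : Polynomial.aeval l (suzukiToMatrix t F g).charpoly = 0 := by
    rw [(isSuzukiMatrix_suzukiToMatrix hF g).charpoly (det_suzukiToMatrix g), htr]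
    simp only [suzukiTheta, map_add, map_mul, map_pow, Polynomial.aeval_X, Polynomial.aeval_C,
      map_one, hb, har]
    rw [ha]; field_simp
    linear_combination (m * l ^ 4 + l ^ 3 + l ^ 3 * m ^ 2 + m * l ^ 2 + l + l * m ^ 2 + m) * h2
  have hg : (suzukiToMatrix t F g).trace ≠ 0 := by
    intro h0
    rw [(isSuzukiMatrix_suzukiToMatrix hF g).charpoly (det_suzukiToMatrix g), h0] at hroot
    simp at hroot
    have hl4 : l ^ 4 = 1 := by linear_combination hroot - h2
    exact hl1 (eq_one_of_pow_eq_one_of_coprime hlN hl4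
      ((coprime_two_of_mem_torusOrders hN).pow_right 2))
  obtain ⟨f, hf, d, hd, hfg, n, hn, hgn, hln⟩ := exists_hom_eq_diagonal hF hg hroot
  refine ⟨g, ?_, ?_⟩
  · intro h1
    rw [h1, map_one] at hfg
    have e0 := congrFun (congrFun hfg 0) 0
    have e1 := congrFun (congrFun hfg 1) 1
    simp only [Matrix.one_apply_eq, Matrix.diagonal_apply_eq] at e0 e1
    exact zero_ne_one (hd (e0.symm.trans e1))
  · by_cases hne : n = 2 ^ (2 * t + 1) + 2 ^ (t + 1) + 1
    · exact hne ▸ hgn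
    · exact absurd (eq_one_of_pow_eq_one_of_coprime hlN hln (coprime_torusOrders hn hne)) hl1

theorem exists_ne_one_pow_eq_one {t : ℕ} {F : Type*} [Field F] [CharP F 2]
    (hF : Nat.card F = 2 ^ (2 * t + 1)) :
    ∃ x : suzukiGroup t F, x ≠ 1 ∧ x ^ (2 ^ (2 * t + 1) + 2 ^ (t + 1) + 1) = 1 :=
  exists_ne_one_pow_eq_one_of_isAlgClosed hF (AlgebraicClosure F)

theorem suzukiGroupT_pow_ne_one {t : ℕ} {F : Type*} [Field F] :
    suzukiGroupT t F ^ (2 ^ (2 * t + 1) + 2 ^ (t + 1) + 1) ≠ 1 := fun h => by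
  have hsq : suzukiGroupT t F ^ 2 = 1 := suzukiToMatrix_injective <| by
    rw [map_pow, map_one, sq]; exact suzukiT_mul_self
  have h1 := eq_one_of_pow_eq_one_of_coprime h hsq
    (coprime_two_of_mem_torusOrders (t := t) (Or.inr (Or.inr rfl)))
  have h2 := congrFun (congrFun (congrArg (suzukiToMatrix t F) h1) 0) 0
  rw [map_one, suzukiToMatrix_suzukiGroupT] at h2
  simp [suzukiT] at h2

theorem EngelEdge.of_commute {G : Type*} [Group G] {x y : G} (h : Commute x y) :
    EngelEdge x y :=
  ⟨1, one_pos, by rw [engelWord, engelWord, mul_assoc, h.eq]; group⟩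

theorem hypercenter_suzukiGroup {t : ℕ} {F : Type*} [Field F] [CharP F 2]
    (hF : Nat.card F = 2 ^ (2 * t + 1)) : hypercenter (suzukiGroup t F) = ⊥ := by
  apply hypercenter_eq_bot_of_center_eq_bot
  rw [eq_bot_iff]
  intro z hz
  rw [Subgroup.mem_center_iff] at hz
  by_contra hz1
  obtain ⟨x, hx1, hx⟩ := exists_ne_one_pow_eq_one hF
  have hzN := (EngelEdge.of_commute (hz x)).pow_eq_one hF hx1 hx
  exact suzukiGroupT_pow_ne_one
    ((EngelEdge.of_commute (hz (suzukiGroupT t F)).symm).pow_eq_one hF hz1 hzN)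

theorem theorem5p4 (t : ℕ) (ht : 1 ≤ t) (F : Type*) [Field F]
    (hF : Nat.card F = 2 ^ (2 * t + 1)) :
    ¬ IsStronglyConnectedDigraph (engelGraph (suzukiGroup t F)) ∧
      ∀ x y : suzukiGroup t F, x ≠ 1 →
        orderOf x ∣ 2 ^ (2 * t + 1) + 2 ^ (t + 1) + 1 →
        EngelEdge x y →
        orderOf y ∣ 2 ^ (2 * t + 1) + 2 ^ (t + 1) + 1 := by
  have hchar := charP_two_of_card hF
  refine ⟨fun hconn => ?_, fun x y hx1 hx h => orderOf_dvd_of_pow_eq_one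
    (h.pow_eq_one hF hx1 (orderOf_dvd_iff_pow_eq_one.1 hx))⟩
  obtain ⟨x, hx1, hx⟩ := exists_ne_one_pow_eq_one hF
  have hT1 : suzukiGroupT t F ≠ 1 := fun h => suzukiGroupT_pow_ne_one (by rw [h, one_pow])
  have hvertex : ∀ z : suzukiGroup t F, z ≠ 1 → z ∉ hypercenter (suzukiGroup t F) := fun z hz => by
    rwa [hypercenter_suzukiGroup hF, Subgroup.mem_bot]
  have hpath := hconn ⟨x, hvertex x hx1⟩ ⟨suzukiGroupT t F, hvertex _ hT1⟩
  have key : ∀ v, Relation.ReflTransGen (engelGraph (suzukiGroup t F)).Adj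
      ⟨x, hvertex x hx1⟩ v → v.1 ^ (2 ^ (2 * t + 1) + 2 ^ (t + 1) + 1) = 1 := fun v hv => by
    induction hv with
    | refl => exact hx
    | @tail u w _ huw ih =>
      have hu1 : u.1 ≠ 1 := fun h => u.2 (h ▸ one_mem _)
      have huw' : EngelEdge u.1 w.1 := huw
      exact huw'.pow_eq_one hF hu1 ih
  exact suzukiGroupT_pow_ne_one (key _ hpath)
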